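/- Let $E_1$, $E_2$ be Banach lattices over the same scalar field $\mathbb{K}\in\{\mathbb{R},\mathbb{C}\}$, with positive cones $(E_1)_+$, $(E_2)_+$, and endow $E_1\times E_2$ with the componentwise order and the maximum norm. A bounded linear operator between Banach lattices is called positive (written $\ge 0$) if it maps the positive cone into the positive cone. A $C_0$-semigroup $(e^{tA})_{t\ge0}$ with generator $A$ on a Banach lattice $E$ is called - individually eventually positive if for each $0\le f\in E$ there is $t_0\ge 0$ such that $e^{tA}f\ge 0$ for all $t\ge t_0$; - uniformly eventually positive if $t_0$ can be chosen independently of $f$; - persistently irreducible if the only closed ideals $I\subseteq E$ for which there is $t_0\ge0$ with $e^{tA}I\subseteq I$ for all $t\ge t_0$ are $I=\{0\}$ and $I=E$. (A vector subspace $I$ is an ideal if $|f|\le|g|$ and $g\in I$ imply $f\in I$.) Let $(e^{tA_1})_{t\ge0}$ and $(e^{tA_2})_{t\ge0}$ be $C_0$-semigroups on $E_1$ and $E_2$, respectively, and let $B_{12}\colon E_2\to E_1$ and $B_{21}\colon E_1\to E_2$ be bounded linear operators such that $$e^{tA_1}B_{12}e^{sA_2}\ge 0\qquad\text{and}\qquad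 e^{tA_2}B_{21}e^{sA_1}\ge0\qquad\text{for all } s,t\ge0.$$ Then the operator $$C:=\begin{pmatrix}A_1&\\&A_2\end{pmatrix}+\begin{pmatrix}&B_{12}\\B_{21}&\end{pmatrix},\qquad \operatorname{dom}C=\operatorname{dom}A_1\times\operatorname{dom}A_2,$$ generates a unique $C_0$-semigroup $(e^{tC})_{t\ge0}$ on $E_1\times E_2$, and the following hold. (a) If both $(e^{tA_1})_{t\ge0}$ and $(e^{tA_2})_{t\ge0}$ are individually eventually positive, then so is $(e^{tC})_{t\ge0}$. If both are uniformly eventually positive, then so is $(e^{tC})_{t\ge0}$. (b) If both $(e^{tA_1})_{t\ge0}$ and $(e^{tA_2})_{t\ge0}$ are individually eventually positive and persistently irreducible, and both $B_{12}$ and $B_{21}$ are non-zero, then $(e^{tC})_{t\ge0}$ is persistently irreducible. -/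

import Mathlib

open Filter Topology
open scoped NNReal

noncomputable section

/-! ### Real and complex Banach lattices

A real Banach lattice is given by Mathlib's classes: a complete normed real vector space with a
lattice order that is compatible with the vector space structure and a solid norm. -/

instance Prod.instHasSolidNorm {X₁ X₂ : Type*} [NormedAddCommGroup X₁] [Lattice X₁]
    [HasSolidNorm X₁] [NormedAddCommGroup X₂] [Lattice X₂] [HasSolidNorm X₂] :
    HasSolidNorm (X₁ × X₂) where
  solid _ _ h := max_le_max (HasSolidNorm.solid h.1) (HasSolidNorm.solid h.2)

instance Prod.instIsOrderedModuleReal {X₁ X₂ : Type*}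
    [NormedAddCommGroup X₁] [NormedSpace ℝ X₁] [Lattice X₁] [IsOrderedModule ℝ X₁]
    [NormedAddCommGroup X₂] [NormedSpace ℝ X₂] [Lattice X₂] [IsOrderedModule ℝ X₂] :
    IsOrderedModule ℝ (X₁ × X₂) where
  smul_le_smul_of_nonneg_left _ hr _ _ h :=
    ⟨smul_le_smul_of_nonneg_left h.1 hr, smul_le_smul_of_nonneg_left h.2 hr⟩
  smul_le_smul_of_nonneg_right _ hx _ _ h :=
    ⟨smul_le_smul_of_nonneg_right h hx.1, smul_le_smul_of_nonneg_right h hx.2⟩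

/-- `BanachLatticeOver 𝕜 X E`: the normed space `E` over `𝕜` (`𝕜 = ℝ` or `𝕜 = ℂ`) is the
Banach lattice over `𝕜` with real part `X`, where `X` is a real Banach lattice.

* `ofReal : X → E` is the embedding of the real part;
* `re : E → X` is the projection onto the real part, and every `z : E` is of the form `x + i y`
  with `x`, `y` in the real part (for `𝕜 = ℝ` one has `RCLike.I = 0`, so that `E = X`);
* `modulus z = |z|` is the supremum in `X` of `re (c z)` over all scalars `c` with `|c| = 1`;
  for `𝕜 = ℝ` this is `z ⊔ -z`, and for `𝕜 = ℂ` it is `sup_θ (x cos θ + y sin θ)`;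
* the norm of `z` is the norm of `|z|`. -/
class BanachLatticeOver (𝕜 : Type*) (X E : Type*) [RCLike 𝕜]
    [NormedAddCommGroup X] [NormedSpace ℝ X] [CompleteSpace X] [Lattice X]
    [IsOrderedAddMonoid X] [IsOrderedModule ℝ X] [HasSolidNorm X]
    [NormedAddCommGroup E] [NormedSpace 𝕜 E] where
  ofReal : X →+ E
  ofReal_smul : ∀ (r : ℝ) (x : X), ofReal (r • x) = (r : 𝕜) • ofReal x
  re : E →+ X
  re_ofReal : ∀ x : X, re (ofReal x) = x
  re_I_smul_ofReal : ∀ x : X, re ((RCLike.I : 𝕜) • ofReal x) = 0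
  exists_decomp : ∀ z : E, ∃ y : X, z = ofReal (re z) + (RCLike.I : 𝕜) • ofReal y
  modulus : E → X
  isLUB_modulus : ∀ z : E, IsLUB {x : X | ∃ c : 𝕜, ‖c‖ = 1 ∧ x = re (c • z)} (modulus z)
  norm_modulus : ∀ z : E, ‖modulus z‖ = ‖z‖

namespace BanachLatticeOver

/-- A real Banach lattice is a Banach lattice over `ℝ` whose real part is the space itself. -/
abbrev ofRealBanachLattice (X : Type*)
    [NormedAddCommGroup X] [NormedSpace ℝ X] [CompleteSpace X] [Lattice X]
    [IsOrderedAddMonoid X] [IsOrderedModule ℝ X] [HasSolidNorm X] :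
    BanachLatticeOver ℝ X X where
  ofReal := AddMonoidHom.id X
  ofReal_smul _ _ := rfl
  re := AddMonoidHom.id X
  re_ofReal _ := rfl
  re_I_smul_ofReal _ := by simp
  exists_decomp z := ⟨0, by simp⟩
  modulus z := |z|
  isLUB_modulus z := by
    have : {x : X | ∃ c : ℝ, ‖c‖ = 1 ∧ x = AddMonoidHom.id X (c • z)} = {z, -z} := by
      ext x
      simp only [Set.mem_ofPred_eq, Set.mem_insert_iff, Set.mem_singleton_iff, Real.norm_eq_abs,
        AddMonoidHom.id_apply]
      constructor
      · rintro ⟨c, hc, rfl⟩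
        rcases eq_or_eq_neg_of_abs_eq hc with rfl | rfl <;> simp
      · rintro (rfl | rfl)
        · exact ⟨1, by simp⟩
        · exact ⟨-1, by simp⟩
    rw [this]
    exact isLUB_pair
  norm_modulus z := norm_abs_eq_norm z

/-- The product of two Banach lattices over `𝕜`, with the componentwise order and the
maximum norm. -/
instance prod {𝕜 X₁ E₁ X₂ E₂ : Type*} [RCLike 𝕜]
    [NormedAddCommGroup X₁] [NormedSpace ℝ X₁] [CompleteSpace X₁] [Lattice X₁]
    [IsOrderedAddMonoid X₁] [IsOrderedModule ℝ X₁] [HasSolidNorm X₁]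
    [NormedAddCommGroup E₁] [NormedSpace 𝕜 E₁]
    [NormedAddCommGroup X₂] [NormedSpace ℝ X₂] [CompleteSpace X₂] [Lattice X₂]
    [IsOrderedAddMonoid X₂] [IsOrderedModule ℝ X₂] [HasSolidNorm X₂]
    [NormedAddCommGroup E₂] [NormedSpace 𝕜 E₂]
    [BanachLatticeOver 𝕜 X₁ E₁] [BanachLatticeOver 𝕜 X₂ E₂] :
    BanachLatticeOver 𝕜 (X₁ × X₂) (E₁ × E₂) where
  ofReal := AddMonoidHom.prodMap (ofReal 𝕜) (ofReal 𝕜)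
  ofReal_smul r x := Prod.ext (ofReal_smul r x.1) (ofReal_smul r x.2)
  re := AddMonoidHom.prodMap (re 𝕜) (re 𝕜)
  re_ofReal x := Prod.ext (re_ofReal x.1) (re_ofReal x.2)
  re_I_smul_ofReal x := Prod.ext (re_I_smul_ofReal x.1) (re_I_smul_ofReal x.2)
  exists_decomp z := by
    obtain ⟨y₁, h₁⟩ := exists_decomp (𝕜 := 𝕜) (X := X₁) z.1
    obtain ⟨y₂, h₂⟩ := exists_decomp (𝕜 := 𝕜) (X := X₂) z.2
    exact ⟨(y₁, y₂), Prod.ext h₁ h₂⟩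
  modulus z := (modulus 𝕜 z.1, modulus 𝕜 z.2)
  isLUB_modulus z := by
    rw [isLUB_prod]
    have h₁ := isLUB_modulus (𝕜 := 𝕜) (X := X₁) z.1
    have h₂ := isLUB_modulus (𝕜 := 𝕜) (X := X₂) z.2
    constructor
    · convert h₁ using 1
      ext x
      constructor
      · rintro ⟨_, ⟨c, hc, rfl⟩, rfl⟩
        exact ⟨c, hc, rfl⟩
      · rintro ⟨c, hc, rfl⟩
        exact ⟨_, ⟨c, hc, rfl⟩, rfl⟩
    · convert h₂ using 1
      ext x
      constructor
      · rintro ⟨_, ⟨c, hc, rfl⟩, rfl⟩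
        exact ⟨c, hc, rfl⟩
      · rintro ⟨c, hc, rfl⟩
        exact ⟨_, ⟨c, hc, rfl⟩, rfl⟩
  norm_modulus z := by
    simp only [Prod.norm_def, norm_modulus]

section Order

variable (𝕜 X : Type*) [RCLike 𝕜]
  [NormedAddCommGroup X] [NormedSpace ℝ X] [CompleteSpace X] [Lattice X]
  [IsOrderedAddMonoid X] [IsOrderedModule ℝ X] [HasSolidNorm X]

/-- `f ∈ E₊`, i.e. `f ≥ 0`. -/
def Nonneg {E : Type*} [NormedAddCommGroup E] [NormedSpace 𝕜 E] [BanachLatticeOver 𝕜 X E]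
    (f : E) : Prop :=
  ∃ x : X, 0 ≤ x ∧ ofReal 𝕜 x = f

/-- A vector subspace `I` is an ideal if `|f| ≤ |g|` and `g ∈ I` imply `f ∈ I`. -/
def IsIdeal {E : Type*} [NormedAddCommGroup E] [NormedSpace 𝕜 E] [BanachLatticeOver 𝕜 X E]
    (I : Submodule 𝕜 E) : Prop :=
  ∀ f g : E, (modulus 𝕜 f : X) ≤ modulus 𝕜 g → g ∈ I → f ∈ I

end Order

/-- A bounded operator is positive if it maps the positive cone to the positive cone. -/
def IsPositiveOperator {𝕜 : Type*} (X Y : Type*) {E F : Type*} [RCLike 𝕜]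
    [NormedAddCommGroup X] [NormedSpace ℝ X] [CompleteSpace X] [Lattice X]
    [IsOrderedAddMonoid X] [IsOrderedModule ℝ X] [HasSolidNorm X]
    [NormedAddCommGroup Y] [NormedSpace ℝ Y] [CompleteSpace Y] [Lattice Y]
    [IsOrderedAddMonoid Y] [IsOrderedModule ℝ Y] [HasSolidNorm Y]
    [NormedAddCommGroup E] [NormedSpace 𝕜 E] [BanachLatticeOver 𝕜 X E]
    [NormedAddCommGroup F] [NormedSpace 𝕜 F] [BanachLatticeOver 𝕜 Y F]
    (T : E →L[𝕜] F) : Prop :=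
  ∀ f : E, Nonneg 𝕜 X f → Nonneg 𝕜 Y (T f)

end BanachLatticeOver

/-! ### `C₀`-semigroups and their generators -/

/-- A `C₀`-semigroup (strongly continuous one-parameter semigroup) of bounded linear operators. -/
@[ext]
structure C0Semigroup (𝕜 E : Type*) [RCLike 𝕜] [NormedAddCommGroup E] [NormedSpace 𝕜 E] where
  toFun : ℝ≥0 → E →L[𝕜] E
  map_zero : toFun 0 = ContinuousLinearMap.id 𝕜 E
  map_add : ∀ s t : ℝ≥0, toFun (s + t) = (toFun s).comp (toFun t)
  continuous_orbit : ∀ f : E, Continuous fun t : ℝ≥0 => toFun t f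

namespace C0Semigroup

variable {𝕜 E : Type*} [RCLike 𝕜] [NormedAddCommGroup E] [NormedSpace 𝕜 E]

instance : CoeFun (C0Semigroup 𝕜 E) fun _ => ℝ≥0 → E →L[𝕜] E := ⟨toFun⟩

/-- The graph of the generator: all `(f, g)` with `(S h f - f) / h → g` as `h ↓ 0`. -/
def generatorGraph (S : C0Semigroup 𝕜 E) : Submodule 𝕜 (E × E) where
  carrier := {p | Tendsto (fun h : ℝ≥0 => (((h : ℝ) : 𝕜))⁻¹ • (S h p.1 - p.1))
    (𝓝[>] 0) (𝓝 p.2)}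
  zero_mem' := by simp
  add_mem' {p q} hp hq := by
    refine (Tendsto.add hp hq).congr fun h => ?_
    simp only [Prod.fst_add, _root_.map_add, ← smul_add]
    congr 1
    abel
  smul_mem' c p hp := by
    refine (Tendsto.const_smul hp c).congr fun h => ?_
    simp only [Prod.smul_fst, _root_.map_smul, ← smul_sub]
    rw [smul_comm]

/-- The generator `A` of the semigroup `S t = e^{tA}`, as a partially defined linear operator. -/
def generator (S : C0Semigroup 𝕜 E) : E →ₗ.[𝕜] E := S.generatorGraph.toLinearPMap

/-- `f ∈ dom A` and `A f = g` if and only if `(S h f - f) / h → g` as `h ↓ 0`. -/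
theorem mem_graph_generator (S : C0Semigroup 𝕜 E) (f g : E) :
    (f, g) ∈ S.generator.graph ↔
      Tendsto (fun h : ℝ≥0 => (((h : ℝ) : 𝕜))⁻¹ • (S h f - f)) (𝓝[>] 0) (𝓝 g) := by
  have hg : ∀ x ∈ S.generatorGraph, x.1 = 0 → x.2 = 0 := by
    rintro ⟨x, y⟩ h hx
    obtain rfl : x = 0 := hx
    have h' : Tendsto (fun _ : ℝ≥0 => (0 : E)) (𝓝[>] 0) (𝓝 y) :=
      Tendsto.congr (fun t => by simp) (show Tendsto _ _ _ from h)
    exact tendsto_nhds_unique h' tendsto_const_nhds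
  rw [generator, Submodule.toLinearPMap_graph_eq _ hg]
  rfl

section BanachLattice

variable (X : Type*) [NormedAddCommGroup X] [NormedSpace ℝ X] [CompleteSpace X] [Lattice X]
  [IsOrderedAddMonoid X] [IsOrderedModule ℝ X] [HasSolidNorm X] [BanachLatticeOver 𝕜 X E]

/-- For every `f ≥ 0` there is a time `t₀` with `S t f ≥ 0` for all `t ≥ t₀`. -/
def IndividuallyEventuallyPositive (S : C0Semigroup 𝕜 E) : Prop :=
  ∀ f : E, BanachLatticeOver.Nonneg 𝕜 X f →
    ∃ t₀ : ℝ≥0, ∀ t ≥ t₀, BanachLatticeOver.Nonneg 𝕜 X (S t f)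

/-- There is a time `t₀` such that `S t ≥ 0` for all `t ≥ t₀`. -/
def UniformlyEventuallyPositive (S : C0Semigroup 𝕜 E) : Prop :=
  ∃ t₀ : ℝ≥0, ∀ f : E, BanachLatticeOver.Nonneg 𝕜 X f →
    ∀ t ≥ t₀, BanachLatticeOver.Nonneg 𝕜 X (S t f)

/-- The only closed ideals `I` with `S t I ⊆ I` for all sufficiently large `t` are `{0}`
and `E`. -/
def PersistentlyIrreducible (S : C0Semigroup 𝕜 E) : Prop :=
  ∀ I : Submodule 𝕜 E, IsClosed (I : Set E) → BanachLatticeOver.IsIdeal 𝕜 X I →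
    (∃ t₀ : ℝ≥0, ∀ t ≥ t₀, ∀ f ∈ I, S t f ∈ I) → I = ⊥ ∨ I = ⊤

end BanachLattice

end C0Semigroup

/-- The operator matrix `[[A₁, B₁₂], [B₂₁, A₂]]` on `E₁ × E₂` with domain `dom A₁ × dom A₂`. -/
def coupledOperator {𝕜 E₁ E₂ : Type*} [RCLike 𝕜]
    [NormedAddCommGroup E₁] [NormedSpace 𝕜 E₁] [NormedAddCommGroup E₂] [NormedSpace 𝕜 E₂]
    (A₁ : E₁ →ₗ.[𝕜] E₁) (A₂ : E₂ →ₗ.[𝕜] E₂) (B₁₂ : E₂ →L[𝕜] E₁) (B₂₁ : E₁ →L[𝕜] E₂) :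
    E₁ × E₂ →ₗ.[𝕜] E₁ × E₂ where
  domain := A₁.domain.prod A₂.domain
  toFun :=
    { toFun := fun p =>
        (A₁ ⟨p.1.1, p.2.1⟩ + B₁₂ p.1.2, B₂₁ p.1.1 + A₂ ⟨p.1.2, p.2.2⟩)
      map_add' := fun p q => by
        have h₁ := A₁.map_add ⟨p.1.1, p.2.1⟩ ⟨q.1.1, q.2.1⟩
        have h₂ := A₂.map_add ⟨p.1.2, p.2.2⟩ ⟨q.1.2, q.2.2⟩
        refine Prod.ext ?_ ?_
        · refine (congrArg₂ (· + ·) h₁ (B₁₂.map_add p.1.2 q.1.2)).trans ?_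
          exact add_add_add_comm _ _ _ _
        · refine (congrArg₂ (· + ·) (B₂₁.map_add p.1.1 q.1.1) h₂).trans ?_
          exact add_add_add_comm _ _ _ _
      map_smul' := fun c p => by
        have h₁ := A₁.map_smul c ⟨p.1.1, p.2.1⟩
        have h₂ := A₂.map_smul c ⟨p.1.2, p.2.2⟩
        refine Prod.ext ?_ ?_
        · refine (congrArg₂ (· + ·) h₁ (B₁₂.map_smul c p.1.2)).trans ?_
          exact (smul_add _ _ _).symm
        · refine (congrArg₂ (· + ·) (B₂₁.map_smul c p.1.1) h₂).trans ?_
          exact (smul_add _ _ _).symm }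

end

noncomputable section

/-! ### Growth, generators and uniqueness of semigroups -/

namespace C0Semigroup

open MeasureTheory Set

variable {𝕜 E : Type*} [RCLike 𝕜] [NormedAddCommGroup E] [NormedSpace 𝕜 E]

/-! Let `T` be the diagonal semigroup and `B` the off-diagonal operator. The coupled semigroup
solves Duhamel's equation `S t x = T t x + ∫ T (t - s) B (S s x) ds`, and iterating it gives the
Dyson–Phillips series. Only its zeroth term `T t x` lacks a factor of the form `T t B (T s x)`, so
the hypotheses make every later term positive on the cone: `S t - T t ≥ 0` at all times, although
neither `T` nor `S` need be positive at small times (`exists_perturbation`,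
`exists_coupled_semigroup`). Uniqueness holds because a generator determines its semigroup
(`eq_of_generator_eq`). Part (a) is then immediate, as `S t f` is a positive vector plus `T t f`.

For (b), let `I` be a closed ideal invariant under `S t` for large `t`, with sections `I₁` and `I₂`.
Domination `0 ≤ T t f ≤ S t f` puts `T t f` into the section eventually, but at a time depending on
`f`; Baire's theorem makes this time uniform (`exists_forall_mem_of_eventually_mem`), so each
section is trivial by irreducibility. If `I = {0} × E₂`, differentiating the vanishing first
component of an `S`-orbit gives `B₁₂ (S t (0, f)).2 = 0`, hence `B₁₂ (T₂ t f) = 0` for large `t` by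
domination. This forces `B₁₂ = 0` (`PersistentlyIrreducible.eq_zero_of_eventually_apply_eq_zero`):
the absolute kernel of `B₁₂` is either everything, or zero, and in the latter case `T₂` is
nilpotent, which is possible only on the zero space. The other mixed case is symmetric. -/

theorem exists_exponential_bound [CompleteSpace E] (S : C0Semigroup 𝕜 E) :
    ∃ M : ℝ, 1 ≤ M ∧ ∃ ω : ℝ, 0 ≤ ω ∧ ∀ t : ℝ≥0, ‖S t‖ ≤ M * Real.exp (ω * t) := by
  obtain ⟨C, hC⟩ : ∃ C, ∀ t : Icc (0 : ℝ≥0) 1, ‖S (t : ℝ≥0)‖ ≤ C := by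
    refine banach_steinhaus fun x => ?_
    obtain ⟨C, hC⟩ := isCompact_Icc.exists_bound_of_continuousOn
      (s := Icc (0 : ℝ≥0) 1) (S.continuous_orbit x).continuousOn
    exact ⟨C, fun t => hC t t.2⟩
  set M := max C 1 with hM
  have hM1 : 1 ≤ M := le_max_right _ _
  have hb : ∀ t : ℝ≥0, t ≤ 1 → ‖S t‖ ≤ M := fun t ht =>
    (hC ⟨t, zero_le, ht⟩).trans (le_max_left _ _)
  have hn : ∀ n : ℕ, ∀ t : ℝ≥0, t ≤ 1 → ‖S (t + n)‖ ≤ M * M ^ n := by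
    intro n
    induction n with
    | zero => intro t ht; simpa using hb t ht
    | succ n ih =>
      intro t ht
      have : t + ((n + 1 : ℕ) : ℝ≥0) = (t + n) + 1 := by push_cast; ring
      rw [this, S.map_add]
      calc _ ≤ ‖S (t + n)‖ * ‖S 1‖ := ContinuousLinearMap.opNorm_comp_le _ _
        _ ≤ (M * M ^ n) * M := by gcongr; exacts [ih t ht, hb 1 le_rfl]
        _ = _ := by ring
  -- With `n = ⌊t⌋₊` one has `M ^ n ≤ M ^ t = exp (t log M)`, whence the rate `log M`.
  refine ⟨M, hM1, Real.log M, Real.log_nonneg hM1, fun t => ?_⟩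
  have h1 : ((⌊t⌋₊ : ℕ) : ℝ≥0) ≤ t := Nat.floor_le zero_le
  have h2 : t - ⌊t⌋₊ ≤ 1 := tsub_le_iff_left.2 (Nat.lt_floor_add_one t).le
  have h3 := hn ⌊t⌋₊ _ h2
  rw [tsub_add_cancel_of_le h1] at h3
  refine h3.trans ?_
  gcongr
  rw [← Real.rpow_def_of_pos (by positivity), ← Real.rpow_natCast]
  exact Real.rpow_le_rpow_of_exponent_le hM1 (by exact_mod_cast h1)

theorem continuous_uncurry [CompleteSpace E] (S : C0Semigroup 𝕜 E) :
    Continuous fun p : ℝ≥0 × E => S p.1 p.2 := by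
  obtain ⟨M, -, ω, -, hb⟩ := S.exists_exponential_bound
  refine continuous_iff_continuousAt.2 fun p₀ => ?_
  rw [ContinuousAt, tendsto_iff_norm_sub_tendsto_zero]
  have hc : Continuous fun p : ℝ≥0 × E =>
      M * Real.exp (ω * p.1) * ‖p.2 - p₀.2‖ + ‖S p.1 p₀.2 - S p₀.1 p₀.2‖ := by
    have := (S.continuous_orbit p₀.2).comp (continuous_fst (X := ℝ≥0) (Y := E))
    simp only [Function.comp_def] at this
    fun_prop
  have hl := hc.tendsto p₀
  simp only [sub_self, norm_zero, mul_zero, add_zero] at hl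
  refine squeeze_zero (fun _ => norm_nonneg _) (fun p => ?_) hl
  calc ‖S p.1 p.2 - S p₀.1 p₀.2‖
      = ‖S p.1 (p.2 - p₀.2) + (S p.1 p₀.2 - S p₀.1 p₀.2)‖ := by rw [_root_.map_sub]; congr 1; abel
    _ ≤ _ := (norm_add_le _ _).trans (by gcongr; exact (S p.1).le_of_opNorm_le (hb _) _)

theorem continuous_comp [CompleteSpace E] (S : C0Semigroup 𝕜 E) {Y : Type*} [TopologicalSpace Y]
    {τ : Y → ℝ≥0} {u : Y → E} (hτ : Continuous τ) (hu : Continuous u) :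
    Continuous fun y => S (τ y) (u y) :=
  S.continuous_uncurry.comp (hτ.prodMk hu)

theorem apply_add (S : C0Semigroup 𝕜 E) (s t : ℝ≥0) (x : E) : S (s + t) x = S s (S t x) := by
  rw [S.map_add]; rfl

theorem apply_zero (S : C0Semigroup 𝕜 E) (x : E) : S 0 x = x := by
  rw [S.map_zero]; rfl

theorem tendsto_toNNReal_nhdsGT_zero : Tendsto Real.toNNReal (𝓝[>] 0) (𝓝[>] 0) := by
  refine tendsto_nhdsWithin_iff.2 ⟨?_, ?_⟩
  · simpa using (continuous_real_toNNReal.tendsto 0).mono_left nhdsWithin_le_nhds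
  · filter_upwards [self_mem_nhdsWithin] with h hh
    exact Real.toNNReal_pos.2 hh

theorem tendsto_coe_nhdsGT_zero : Tendsto ((↑) : ℝ≥0 → ℝ) (𝓝[>] 0) (𝓝[>] 0) := by
  refine tendsto_nhdsWithin_iff.2 ⟨?_, ?_⟩
  · simpa using (NNReal.continuous_coe.tendsto 0).mono_left nhdsWithin_le_nhds
  · filter_upwards [self_mem_nhdsWithin] with h hh
    exact NNReal.coe_pos.2 hh

theorem apply_mem_graph_generator (S : C0Semigroup 𝕜 E) {f g : E}
    (h : (f, g) ∈ S.generator.graph) (s : ℝ≥0) : (S s f, S s g) ∈ S.generator.graph := by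
  rw [mem_graph_generator] at h ⊢
  refine (((S s).continuous.tendsto g).comp h).congr fun r => ?_
  simp only [Function.comp_apply, _root_.map_smul, _root_.map_sub]
  rw [← apply_add, ← apply_add, add_comm]

/-- The mean value of a jointly continuous family over a short interval. -/
theorem tendsto_average {E : Type*} [NormedAddCommGroup E] [NormedSpace ℝ E] [CompleteSpace E]
    {k : ℝ → ℝ → E} (hk : Continuous (Function.uncurry k)) :
    Tendsto (fun h : ℝ => h⁻¹ • ∫ s in (0 : ℝ)..h, k h s) (𝓝[>] 0) (𝓝 (k 0 0)) := by
  -- Rescaling the average to the fixed interval `[0, 1]` makes it continuous in `h`, including at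
  -- `0`.
  have hc : Continuous fun h : ℝ => ∫ s in (0 : ℝ)..1, k h (h * s) := by
    refine intervalIntegral.continuous_parametric_intervalIntegral_of_continuous (f := fun h s =>
      k h (h * s)) ?_ continuous_const
    exact hk.comp (f := fun p : ℝ × ℝ => (p.1, p.1 * p.2)) (by fun_prop)
  have h0 := (hc.tendsto 0).mono_left (nhdsWithin_le_nhds (s := Ioi 0))
  simp only [zero_mul, intervalIntegral.integral_const, sub_zero, one_smul] at h0
  refine h0.congr' ?_
  filter_upwards [self_mem_nhdsWithin] with h hh
  rw [intervalIntegral.integral_comp_mul_left (fun s => k h s) (ne_of_gt hh)]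
  simp

variable [NormedSpace ℝ E] [IsScalarTower ℝ 𝕜 E]

theorem tendsto_quotient_real {φ : ℝ≥0 → E} {g : E}
    (h : Tendsto (fun h : ℝ≥0 => (((h : ℝ) : 𝕜))⁻¹ • φ h) (𝓝[>] 0) (𝓝 g)) :
    Tendsto (fun h : ℝ => h⁻¹ • φ h.toNNReal) (𝓝[>] 0) (𝓝 g) := by
  refine (h.comp tendsto_toNNReal_nhdsGT_zero).congr' ?_
  filter_upwards [self_mem_nhdsWithin] with r hr
  simp only [Function.comp_apply]
  rw [Real.coe_toNNReal r (le_of_lt hr), ← RCLike.ofReal_inv, ← RCLike.real_smul_eq_coe_smul]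

/-- The path `s ↦ S (t - s) (S' s f)` joins `S t f` to `S' t f` and has zero right derivative, since
the two generators cancel. -/
theorem eq_on_domain_of_generator_eq [CompleteSpace E] {S S' : C0Semigroup 𝕜 E}
    (h : S.generator = S'.generator) {f g : E} (hf : (f, g) ∈ S'.generator.graph) (t : ℝ≥0) :
    S' t f = S t f := by
  set φ : ℝ → E := fun s => S (t - s).toNNReal (S' s.toNNReal f) with hφ
  have hcont : Continuous φ := S.continuous_comp (by fun_prop)
    ((S'.continuous_orbit f).comp continuous_real_toNNReal)
  have hder : ∀ s ∈ Ico (0 : ℝ) t, HasDerivWithinAt φ 0 (Ici s) s := by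
    intro s hs
    have h' := S'.apply_mem_graph_generator hf s.toNNReal
    have hS : (S' s.toNNReal f, S' s.toNNReal g) ∈ S.generator.graph := by rw [h]; exact h'
    set x := S' s.toNNReal f with hx
    have q' := tendsto_quotient_real ((mem_graph_generator _ _ _).1 h')
    have q := tendsto_quotient_real ((mem_graph_generator _ _ _).1 hS)
    have q0 := q'.sub q
    rw [sub_self] at q0
    rw [hasDerivWithinAt_iff_tendsto_slope, show Ici s \ {s} = Ioi s from by ext y; simp [lt_iff_le_and_ne]]
    have hsub : Tendsto (fun y : ℝ => y - s) (𝓝[>] s) (𝓝[>] 0) := by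
      refine tendsto_nhdsWithin_iff.2 ⟨?_, ?_⟩
      · have : Continuous fun y : ℝ => y - s := by fun_prop
        simpa using (this.tendsto s).mono_left nhdsWithin_le_nhds
      · filter_upwards [self_mem_nhdsWithin] with y hy
        exact mem_Ioi.2 (sub_pos.2 (mem_Ioi.1 hy))
    have hτ : Tendsto (fun y : ℝ => (t - y).toNNReal) (𝓝[>] s) (𝓝 (t - s).toNNReal) := by
      have : Continuous fun y : ℝ => (t - y).toNNReal := by fun_prop
      exact (this.tendsto s).mono_left nhdsWithin_le_nhds
    -- The slope of `φ` is `S (t - y)` applied to the difference of the two generator quotients at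
    -- `x`. That difference tends to `0`, and joint continuity handles the moving operator.
    have key := (S.continuous_uncurry.tendsto ((t - s).toNNReal, 0)).comp
      (hτ.prodMk_nhds (q0.comp hsub))
    simp only [_root_.map_zero] at key
    refine key.congr' ?_
    filter_upwards [Ioo_mem_nhdsGT hs.2] with y hy
    have h1 : y.toNNReal = (y - s).toNNReal + s.toNNReal := by
      rw [← Real.toNNReal_add (sub_nonneg.2 hy.1.le) hs.1]; congr 1; ring
    have h2 : ((t : ℝ) - s).toNNReal = (t - y).toNNReal + (y - s).toNNReal := by
      rw [← Real.toNNReal_add (sub_nonneg.2 hy.2.le) (sub_nonneg.2 hy.1.le)]; congr 1; ring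
    simp only [Function.comp_apply, slope_def_module, hφ]
    rw [h2, h1, S.apply_add, S'.apply_add, ← hx, RCLike.real_smul_eq_coe_smul (K := 𝕜),
      RCLike.real_smul_eq_coe_smul (K := 𝕜), RCLike.real_smul_eq_coe_smul (K := 𝕜), ← smul_sub,
      _root_.map_smul]
    congr 1
    simp only [_root_.map_sub]
    abel
  have := constant_of_has_deriv_right_zero hcont.continuousOn hder t ⟨t.2, le_rfl⟩
  simpa [hφ, apply_zero] using this

/-- Short-time averages of an orbit lie in the domain and converge to its starting point. -/
theorem dense_domain_generator [CompleteSpace E] (S : C0Semigroup 𝕜 E) :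
    Dense (S.generator.domain : Set E) := by
  intro f
  set u : ℝ → E := fun s => S s.toNNReal f with hu
  have huc : Continuous u := (S.continuous_orbit f).comp continuous_real_toNNReal
  have hlim := tendsto_average (k := fun _ s => u s) (huc.comp continuous_snd)
  have hu0 : u 0 = f := by simp [hu, apply_zero]
  rw [hu0] at hlim
  refine mem_closure_of_tendsto hlim ?_
  filter_upwards [self_mem_nhdsWithin] with τ hτ
  have hmem : (∫ s in (0 : ℝ)..τ, u s) ∈ S.generator.domain := by
    refine LinearPMap.mem_domain_iff.2 ⟨u τ - f, ?_⟩
    rw [mem_graph_generator]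
    have l1 := tendsto_average (k := fun _ s => u (τ + s))
      (show Continuous (fun p : ℝ × ℝ => u (τ + p.2)) from huc.comp (by fun_prop))
    have l2 := (l1.sub hlim).comp tendsto_coe_nhdsGT_zero
    simp only [add_zero] at l2
    -- The quotient of the integral telescopes into two averages over length `h`, one starting at
    -- `τ` and one at `0`.
    refine l2.congr fun h => ?_
    simp only [Function.comp_apply]
    rw [← smul_sub, RCLike.real_smul_eq_coe_smul (K := 𝕜), RCLike.ofReal_inv]
    congr 1
    have hi : ∀ a b : ℝ, IntervalIntegrable u volume a b := fun a b => huc.intervalIntegrable a b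
    have e1 : S h (∫ s in (0 : ℝ)..τ, u s) = ∫ s in (0 : ℝ)..τ, u (s + h) := by
      rw [← ContinuousLinearMap.intervalIntegral_comp_comm _ (hi 0 τ)]
      refine intervalIntegral.integral_congr fun s hs => ?_
      rw [uIcc_of_le (le_of_lt hτ)] at hs
      simp only [hu]
      rw [← apply_add, add_comm, Real.toNNReal_add hs.1 h.coe_nonneg, Real.toNNReal_coe]
    rw [e1, intervalIntegral.integral_comp_add_right, intervalIntegral.integral_comp_add_left,
      ← intervalIntegral.integral_add_adjacent_intervals (hi 0 (h : ℝ)) (hi h τ),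
      zero_add, add_zero,
      ← intervalIntegral.integral_add_adjacent_intervals (hi (h : ℝ) τ) (hi τ (τ + h)),
      add_comm τ (h : ℝ)]
    abel
  rw [RCLike.real_smul_eq_coe_smul (K := 𝕜)]
  exact S.generator.domain.smul_mem _ hmem

theorem eq_of_generator_eq [CompleteSpace E] {S S' : C0Semigroup 𝕜 E}
    (h : S.generator = S'.generator) : S = S' := by
  refine C0Semigroup.ext (funext fun t => ContinuousLinearMap.ext fun f => ?_)
  refine congrFun (Continuous.ext_on S.dense_domain_generator (S t).continuous (S' t).continuous
    fun f hf => ?_) f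
  obtain ⟨g, hg⟩ := LinearPMap.mem_domain_iff.1 hf
  exact eq_on_domain_of_generator_eq h.symm hg t

end C0Semigroup

/-! ### Bounded perturbations through a Volterra equation -/

open scoped BoundedContinuousFunction

/-- The integral of a continuous function with values in a closed cone lies in the cone. -/
theorem integral_mem_closed_cone {E : Type*} [NormedAddCommGroup E] [NormedSpace ℝ E]
    [CompleteSpace E] {K : Submodule ℝ≥0 E} (hK : IsClosed (K : Set E)) {g : ℝ → E}
    (hg : Continuous g) {t : ℝ} (ht : 0 ≤ t) (hmem : ∀ s ∈ Set.Icc 0 t, g s ∈ K) :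
    ∫ s in (0 : ℝ)..t, g s ∈ K := by
  rcases ht.eq_or_lt with rfl | ht
  · simp
  have hconv : Convex ℝ (K : Set E) := fun x hx y hy a b ha hb _ =>
    K.add_mem (K.smul_mem ⟨a, ha⟩ hx) (K.smul_mem ⟨b, hb⟩ hy)
  have hav := hconv.set_average_mem (μ := MeasureTheory.volume) (t := Set.Ioc 0 t) (f := g) hK
    (by simp [ht]) (by simp)
    ((MeasureTheory.ae_restrict_iff' measurableSet_Ioc).2
      (Eventually.of_forall fun s hs => hmem s ⟨hs.1.le, hs.2⟩))
    hg.integrableOn_Ioc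
  rw [MeasureTheory.setAverage_eq] at hav
  have : t • ((MeasureTheory.volume.real (Set.Ioc 0 t))⁻¹ • ∫ s in Set.Ioc 0 t, g s) ∈ K :=
    K.smul_mem (⟨t, ht.le⟩ : ℝ≥0) hav
  rw [intervalIntegral.integral_of_le ht.le]
  simpa [smul_smul, ht.le, ht.ne'] using this

theorem integral_exp_neg_mul_sub_le {κ : ℝ} (hκ : 0 < κ) (t : ℝ) :
    ∫ s in (0 : ℝ)..t, Real.exp (-κ * (t - s)) ≤ κ⁻¹ := by
  have hd : ∀ s : ℝ, HasDerivAt (fun s => κ⁻¹ * Real.exp (-κ * (t - s)))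
      (Real.exp (-κ * (t - s))) s := by
    intro s
    have h1 : HasDerivAt (fun s => -κ * (t - s)) κ s := by
      simpa using ((hasDerivAt_id s).const_sub t).const_mul (-κ)
    have h2 := h1.exp.const_mul κ⁻¹
    refine h2.congr_deriv ?_
    rw [mul_comm (Real.exp _), inv_mul_cancel_left₀ hκ.ne']
  rw [intervalIntegral.integral_eq_sub_of_hasDerivAt (fun s _ => hd s)
    (Continuous.intervalIntegrable (by fun_prop) _ _)]
  have : 0 ≤ κ⁻¹ * Real.exp (-κ * (t - 0)) := by positivity
  simp only [sub_self, mul_zero, Real.exp_zero, mul_one]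
  linarith

/-- All three properties of the geometric series are needed: the fixed-point equation is Duhamel's
formula, uniqueness yields the semigroup law, and the series carries positivity. -/
theorem exists_neumann_inverse {𝕜 F : Type*} [RCLike 𝕜] [NormedAddCommGroup F] [NormedSpace 𝕜 F]
    [CompleteSpace F] (V : F →L[𝕜] F) (hV : ‖V‖ < 1) :
    ∃ R : F →L[𝕜] F, (∀ v, R v = v + V (R v)) ∧ (∀ v w, w = v + V w → w = R v) ∧
      ∀ v, HasSum (fun n : ℕ => (V ^ n) v) (R v) := by
  have hs : Summable fun n : ℕ => V ^ n := summable_geometric_of_norm_lt_one hV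
  refine ⟨∑' n : ℕ, V ^ n, fun v => ?_, fun v w hw => ?_, fun v => ?_⟩
  · have : (∑' n : ℕ, V ^ n) v - V ((∑' n : ℕ, V ^ n) v) = v :=
      congrArg (fun W : F →L[𝕜] F => W v) (mul_neg_geom_series V hV)
    exact sub_eq_iff_eq_add.1 this
  · have : (∑' n : ℕ, V ^ n) (w - V w) = w :=
      congrArg (fun W : F →L[𝕜] F => W w) (geom_series_mul_neg V hV)
    rw [← this, sub_eq_of_eq_add hw]
  · exact hs.hasSum.mapL (ContinuousLinearMap.apply 𝕜 F v)

namespace C0Semigroup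

variable {𝕜 E : Type*} [RCLike 𝕜] [NormedAddCommGroup E] [NormedSpace 𝕜 E]

theorem exists_orbit_map (T : C0Semigroup 𝕜 E) {M : ℝ} (hT : ∀ t, ‖T t‖ ≤ M) :
    ∃ O : E →L[𝕜] (ℝ≥0 →ᵇ E), ∀ x t, O x t = T t x := by
  have hb : ∀ x t, ‖T t x‖ ≤ M * ‖x‖ := fun x t => (T t).le_of_opNorm_le (hT t) x
  refine ⟨LinearMap.mkContinuous
    { toFun := fun x => BoundedContinuousFunction.ofNormedAddCommGroup (fun t => T t x)
        (T.continuous_orbit x) _ (hb x)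
      map_add' := fun x y => by ext t; simp
      map_smul' := fun c x => by ext t; simp } M fun x => ?_, fun x t => rfl⟩
  have hM : 0 ≤ M := (norm_nonneg _).trans (hT 0)
  exact (BoundedContinuousFunction.norm_le (by positivity)).2 (hb x)

variable [CompleteSpace E]

theorem continuous_duhamel_kernel (T : C0Semigroup 𝕜 E) (B : E →L[𝕜] E) {u : ℝ≥0 → E}
    (hu : Continuous u) :
    Continuous (Function.uncurry fun t s : ℝ => T (t - s).toNNReal (B (u s.toNNReal))) :=
  T.continuous_comp (Y := ℝ × ℝ) (τ := fun p => (p.1 - p.2).toNNReal)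
    (u := fun p => B (u p.2.toNNReal)) (by fun_prop) (by fun_prop)

variable [NormedSpace ℝ E] [IsScalarTower ℝ 𝕜 E]

/-- Exponential decay bounds the Duhamel integral by `M ‖B‖ / κ < 1` uniformly in time, so one
contraction on bounded functions covers the whole half-line. -/
theorem exists_volterra_map (T : C0Semigroup 𝕜 E) (B : E →L[𝕜] E) {M κ : ℝ}
    (hT : ∀ t : ℝ≥0, ‖T t‖ ≤ M * Real.exp (-κ * t)) (hκ : M * ‖B‖ < κ) :
    ∃ V : (ℝ≥0 →ᵇ E) →L[𝕜] (ℝ≥0 →ᵇ E), ‖V‖ < 1 ∧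
      ∀ u t, V u t = ∫ s in (0 : ℝ)..t, T (t - s).toNNReal (B (u s.toNNReal)) := by
  have hM : 0 ≤ M := by simpa using (norm_nonneg _).trans (hT 0)
  have hκ0 : 0 < κ := lt_of_le_of_lt (by positivity) hκ
  have hc : ∀ (u : ℝ≥0 →ᵇ E) (t : ℝ),
      Continuous fun s : ℝ => T (t - s).toNNReal (B (u s.toNNReal)) := fun u t =>
    (continuous_duhamel_kernel T B u.continuous).comp (f := fun s : ℝ => (t, s)) (by fun_prop)
  have hcont : ∀ u : ℝ≥0 →ᵇ E, Continuous fun t : ℝ≥0 =>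
      ∫ s in (0 : ℝ)..t, T (t - s).toNNReal (B (u s.toNNReal)) := fun u =>
    (intervalIntegral.continuous_parametric_intervalIntegral_of_continuous
      (continuous_duhamel_kernel T B u.continuous) continuous_id).comp NNReal.continuous_coe
  have hb : ∀ (u : ℝ≥0 →ᵇ E) (t : ℝ≥0),
      ‖∫ s in (0 : ℝ)..t, T (t - s).toNNReal (B (u s.toNNReal))‖ ≤ M * ‖B‖ * κ⁻¹ * ‖u‖ := by
    intro u t
    refine (intervalIntegral.norm_integral_le_of_norm_le t.coe_nonneg
      (g := fun s => (M * ‖B‖ * ‖u‖) * Real.exp (-κ * (t - s)))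
      (Eventually.of_forall fun s hs => ?_)
      (Continuous.intervalIntegrable (by fun_prop) _ _)).trans ?_
    · have h1 := hT (t - s).toNNReal
      rw [Real.coe_toNNReal _ (sub_nonneg.2 hs.2)] at h1
      have h2 : ‖B (u s.toNNReal)‖ ≤ ‖B‖ * ‖u‖ :=
        (B.le_opNorm _).trans (by gcongr; exact u.norm_coe_le_norm _)
      calc _ ≤ M * Real.exp (-κ * (t - s)) * (‖B‖ * ‖u‖) :=
            (ContinuousLinearMap.le_of_opNorm_le _ h1 _).trans (by gcongr)
        _ = _ := by ring
    · rw [intervalIntegral.integral_const_mul]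
      calc _ ≤ (M * ‖B‖ * ‖u‖) * κ⁻¹ := by gcongr; exact integral_exp_neg_mul_sub_le hκ0 _
        _ = _ := by ring
  refine ⟨LinearMap.mkContinuous
    { toFun := fun u => BoundedContinuousFunction.ofNormedAddCommGroup _ (hcont u) _ (hb u)
      map_add' := fun u v => by
        ext t
        simp only [BoundedContinuousFunction.coe_ofNormedAddCommGroup,
          BoundedContinuousFunction.coe_add, Pi.add_apply, _root_.map_add]
        exact intervalIntegral.integral_add ((hc u t).intervalIntegrable _ _)
          ((hc v t).intervalIntegrable _ _)
      map_smul' := fun c u => by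
        ext t
        simp only [BoundedContinuousFunction.coe_ofNormedAddCommGroup,
          BoundedContinuousFunction.coe_smul, _root_.map_smul, RingHom.id_apply]
        exact intervalIntegral.integral_smul c _ } (M * ‖B‖ * κ⁻¹) fun u => ?_, ?_,
      fun u t => rfl⟩
  · exact (BoundedContinuousFunction.norm_le (by positivity)).2 (hb u)
  · refine (LinearMap.mkContinuous_norm_le _ (by positivity) _).trans_lt ?_
    rwa [← div_eq_mul_inv, div_lt_one hκ0]

/-- Bounded perturbations of an exponentially stable semigroup: there is a semigroup solving
Duhamel's equation, and its deviation from `T` is positive if the perturbation is. -/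
theorem exists_perturbation_of_stable (T : C0Semigroup 𝕜 E) (B : E →L[𝕜] E) {M κ : ℝ}
    (hT : ∀ t : ℝ≥0, ‖T t‖ ≤ M * Real.exp (-κ * t)) (hκ : M * ‖B‖ < κ) :
    ∃ S : C0Semigroup 𝕜 E,
      (∀ x, Tendsto (fun h : ℝ≥0 => (((h : ℝ) : 𝕜))⁻¹ • (S h x - T h x)) (𝓝[>] 0) (𝓝 (B x))) ∧
      ∀ K : Submodule ℝ≥0 E, IsClosed (K : Set E) → (∀ t, ∀ x ∈ K, T t (B x) ∈ K) →
        (∀ t s, ∀ x ∈ K, T t (B (T s x)) ∈ K) → ∀ t, ∀ x ∈ K, S t x - T t x ∈ K := by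
  have hM : 0 ≤ M := by simpa using (norm_nonneg _).trans (hT 0)
  have hκ0 : 0 < κ := lt_of_le_of_lt (by positivity) hκ
  obtain ⟨V, hV1, hV⟩ := exists_volterra_map T B hT hκ
  obtain ⟨O, hO⟩ := T.exists_orbit_map (M := M) fun t => (hT t).trans
    (mul_le_of_le_one_right hM (Real.exp_le_one_iff.2
      (mul_nonpos_of_nonpos_of_nonneg (neg_nonpos.2 hκ0.le) t.2)))
  obtain ⟨R, hR, hRu, hRs⟩ := exists_neumann_inverse V hV1
  have hc : ∀ (u : ℝ≥0 →ᵇ E) (t : ℝ),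
      Continuous fun s : ℝ => T (t - s).toNNReal (B (u s.toNNReal)) := fun u t =>
    (continuous_duhamel_kernel T B u.continuous).comp (f := fun s : ℝ => (t, s)) (by fun_prop)
  have hduh : ∀ x (t : ℝ≥0), R (O x) t =
      T t x + ∫ s in (0 : ℝ)..t, T (t - s).toNNReal (B (R (O x) s.toNNReal)) := by
    intro x t
    rw [← hV, ← hO]
    exact congrArg (fun u : ℝ≥0 →ᵇ E => u t) (hR (O x))
  -- Semigroup law: the translated solution solves the Volterra equation with initial value `R (O x)
  -- s`, so uniqueness applies. Splitting the integral at `s` verifies this.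
  have hshift : ∀ x (s t : ℝ≥0), R (O x) (t + s) = R (O (R (O x) s)) t := by
    intro x s t
    have := hRu (O (R (O x) s))
      ((R (O x)).compContinuous ⟨fun r : ℝ≥0 => r + s, by fun_prop⟩) (by
        ext r
        have hi : ∀ a b : ℝ, IntervalIntegrable (fun q : ℝ =>
            T (((r + s : ℝ≥0) : ℝ) - q).toNNReal (B (R (O x) q.toNNReal)))
            MeasureTheory.volume a b := fun a b => (hc (R (O x)) _).intervalIntegrable a b
        simp only [BoundedContinuousFunction.compContinuous_apply, ContinuousMap.coe_mk,
          BoundedContinuousFunction.coe_add, Pi.add_apply, hO, hV]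
        rw [hduh x (r + s), hduh x s, _root_.map_add, ← apply_add, add_assoc]
        congr 1
        rw [← intervalIntegral.integral_add_adjacent_intervals (hi 0 s) (hi s (r + s : ℝ≥0)),
          ← ContinuousLinearMap.intervalIntegral_comp_comm _
            ((hc (R (O x)) s).intervalIntegrable _ _)]
        congr 1
        · refine intervalIntegral.integral_congr fun q hq => ?_
          rw [Set.uIcc_of_le s.coe_nonneg] at hq
          rw [← apply_add, NNReal.coe_add, add_sub_assoc,
            Real.toNNReal_add r.coe_nonneg (sub_nonneg.2 hq.2), Real.toNNReal_coe]
        · have := intervalIntegral.integral_comp_add_right (a := 0) (b := r) (fun q : ℝ =>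
            T (((r + s : ℝ≥0) : ℝ) - q).toNNReal (B (R (O x) q.toNNReal))) s
          rw [zero_add, ← NNReal.coe_add] at this
          rw [← this]
          refine intervalIntegral.integral_congr fun q hq => ?_
          rw [Set.uIcc_of_le r.coe_nonneg] at hq
          rw [NNReal.coe_add, add_sub_add_right_eq_sub, Real.toNNReal_add hq.1 s.coe_nonneg,
            Real.toNNReal_coe])
    exact congrArg (fun u : ℝ≥0 →ᵇ E => u t) this
  let S : C0Semigroup 𝕜 E :=
    { toFun := fun t => (BoundedContinuousFunction.evalCLM 𝕜 t).comp (R.comp O)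
      map_zero := by
        ext x
        have := hduh x 0
        simp only [NNReal.coe_zero, intervalIntegral.integral_same, add_zero, apply_zero] at this
        exact this
      map_add := fun s t => by
        ext x
        exact hshift x t s
      continuous_orbit := fun x => (R (O x)).continuous }
  have hS : ∀ t x, S t x = R (O x) t := fun _ _ => rfl
  refine ⟨S, fun x => ?_, fun K hK h1 h2 t x hx => ?_⟩
  · have hk := (tendsto_average (continuous_duhamel_kernel T B (R (O x)).continuous)).comp
      tendsto_coe_nhdsGT_zero
    have h0 : T ((0 : ℝ) - 0).toNNReal (B (R (O x) (0 : ℝ).toNNReal)) = B x := by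
      rw [← hS]; simp [apply_zero]
    rw [h0] at hk
    refine hk.congr fun h => ?_
    simp only [Function.comp_apply]
    rw [hS, hduh, add_sub_cancel_left, RCLike.real_smul_eq_coe_smul (K := 𝕜), RCLike.ofReal_inv]
  · have hVK : ∀ u : ℝ≥0 →ᵇ E, (∀ s, u s ∈ K) → ∀ s, V u s ∈ K := by
      intro u hu s
      rw [hV]
      exact integral_mem_closed_cone hK (hc u s) s.coe_nonneg fun r _ => h1 _ _ (hu _)
    have h0 : ∀ s, V (O x) s ∈ K := by
      intro s
      rw [hV]
      refine integral_mem_closed_cone hK (hc (O x) s) s.coe_nonneg fun r _ => ?_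
      rw [hO]
      exact h2 _ _ _ hx
    have hn : ∀ n : ℕ, ∀ s, (V ^ n) (V (O x)) s ∈ K := by
      intro n
      induction n with
      | zero => exact h0
      | succ n ih =>
        intro s
        rw [pow_succ']
        exact hVK _ ih s
    -- This drops the zeroth series term, the only one that may leave `K`. The remaining ones start
    -- from `V (O x)`, which is `K`-valued even where `O x` is not.
    have hdiff : S t x - T t x = R (V (O x)) t := by
      have e : R (O x) = O x + R (V (O x)) := by
        refine (hRu _ _ ?_).symm
        rw [_root_.map_add, ← hR (V (O x))]
      rw [hS, e, BoundedContinuousFunction.coe_add, Pi.add_apply, hO, add_sub_cancel_left]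
    rw [hdiff]
    have hsum := (hRs (V (O x))).mapL (BoundedContinuousFunction.evalCLM 𝕜 t)
    exact hK.mem_of_tendsto hsum (Eventually.of_forall fun s => K.sum_mem fun n _ => hn n t)

end C0Semigroup

/-! ### Rescaling, products and the coupled generator -/

namespace C0Semigroup

section Rescale

variable {𝕜 E : Type*} [RCLike 𝕜] [NormedAddCommGroup E] [NormedSpace 𝕜 E]

/-- The rescaled semigroup `e^{at} S t`. -/
def rescale (S : C0Semigroup 𝕜 E) (a : ℝ) : C0Semigroup 𝕜 E where
  toFun t := ((Real.exp (a * t) : ℝ) : 𝕜) • S t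
  map_zero := by simp [S.map_zero]
  map_add s t := by
    ext x
    change ((Real.exp (a * (s + t : ℝ≥0)) : ℝ) : 𝕜) • S (s + t) x =
      ((Real.exp (a * s) : ℝ) : 𝕜) • S s (((Real.exp (a * t) : ℝ) : 𝕜) • S t x)
    rw [apply_add, _root_.map_smul, smul_smul, ← RCLike.ofReal_mul, ← Real.exp_add,
      NNReal.coe_add, mul_add]
  continuous_orbit f := by
    have h1 : Continuous fun t : ℝ≥0 => ((Real.exp (a * t) : ℝ) : 𝕜) :=
      RCLike.continuous_ofReal.comp (by fun_prop)
    exact h1.smul (S.continuous_orbit f)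

theorem rescale_apply (S : C0Semigroup 𝕜 E) (a : ℝ) (t : ℝ≥0) (x : E) :
    S.rescale a t x = ((Real.exp (a * t) : ℝ) : 𝕜) • S t x := rfl

variable [CompleteSpace E] [NormedSpace ℝ E] [IsScalarTower ℝ 𝕜 E]

/-- Bounded perturbation theorem: the perturbed semigroup differs from `T` to first order by `B`,
and the difference is positive if the perturbation is positive along `T`. -/
theorem exists_perturbation (T : C0Semigroup 𝕜 E) (B : E →L[𝕜] E) :
    ∃ S : C0Semigroup 𝕜 E,
      (∀ x, Tendsto (fun h : ℝ≥0 => (((h : ℝ) : 𝕜))⁻¹ • (S h x - T h x)) (𝓝[>] 0) (𝓝 (B x))) ∧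
      ∀ K : Submodule ℝ≥0 E, IsClosed (K : Set E) → (∀ t, ∀ x ∈ K, T t (B x) ∈ K) →
        (∀ t s, ∀ x ∈ K, T t (B (T s x)) ∈ K) → ∀ t, ∀ x ∈ K, S t x - T t x ∈ K := by
  obtain ⟨M, hM, ω, -, hT⟩ := T.exists_exponential_bound
  -- After damping by `a` the decay rate is `M * ‖B‖ + 1`, just above the contraction threshold.
  set a : ℝ := ω + (M * ‖B‖ + 1) with ha
  have hT' : ∀ t : ℝ≥0, ‖T.rescale (-a) t‖ ≤ M * Real.exp (-(M * ‖B‖ + 1) * t) := by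
    intro t
    have e : T.rescale (-a) t = ((Real.exp (-a * t) : ℝ) : 𝕜) • T t := rfl
    rw [e, norm_smul, RCLike.norm_ofReal, abs_of_pos (Real.exp_pos _)]
    calc _ ≤ Real.exp (-a * t) * (M * Real.exp (ω * t)) := by gcongr; exact hT t
      _ = M * (Real.exp (-a * t) * Real.exp (ω * t)) := by ring
      _ = _ := by rw [← Real.exp_add, ha]; congr 2; ring
  obtain ⟨S, hS, hK⟩ := exists_perturbation_of_stable (T.rescale (-a)) B hT' (lt_add_one _)
  have hdiff : ∀ t x, S.rescale a t x - T t x =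
      ((Real.exp (a * t) : ℝ) : 𝕜) • (S t x - T.rescale (-a) t x) := by
    intro t x
    rw [rescale_apply, rescale_apply, smul_sub, smul_smul, ← RCLike.ofReal_mul, ← Real.exp_add]
    simp
  have hmem : ∀ (K : Submodule ℝ≥0 E) (c : ℝ) (x : E), x ∈ K →
      ((Real.exp c : ℝ) : 𝕜) • x ∈ K := by
    intro K c x hx
    rw [← RCLike.real_smul_eq_coe_smul]
    exact K.smul_mem (⟨Real.exp c, (Real.exp_pos c).le⟩ : ℝ≥0) hx
  refine ⟨S.rescale a, fun x => ?_, fun K hKc h1 h2 t x hx => ?_⟩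
  · have hexp : Tendsto (fun h : ℝ≥0 => ((Real.exp (a * h) : ℝ) : 𝕜)) (𝓝[>] 0) (𝓝 1) := by
      have hc : Continuous fun h : ℝ≥0 => ((Real.exp (a * h) : ℝ) : 𝕜) :=
        RCLike.continuous_ofReal.comp (by fun_prop)
      simpa using (hc.tendsto 0).mono_left nhdsWithin_le_nhds
    have := hexp.smul (hS x)
    rw [one_smul] at this
    refine this.congr fun h => ?_
    rw [hdiff, smul_comm]
  · rw [hdiff]
    refine hmem K _ _ (hK K hKc (fun t x hx => ?_) (fun t s x hx => ?_) t x hx)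
    · exact hmem K _ _ (h1 t x hx)
    · rw [rescale_apply, rescale_apply, _root_.map_smul, _root_.map_smul]
      exact hmem K _ _ (hmem K _ _ (h2 t s x hx))

end Rescale

section Product

variable {𝕜 E₁ E₂ : Type*} [RCLike 𝕜] [NormedAddCommGroup E₁] [NormedSpace 𝕜 E₁]
  [NormedAddCommGroup E₂] [NormedSpace 𝕜 E₂]

/-- The diagonal semigroup on a product. -/
def prod (T₁ : C0Semigroup 𝕜 E₁) (T₂ : C0Semigroup 𝕜 E₂) : C0Semigroup 𝕜 (E₁ × E₂) where
  toFun t := (T₁ t).prodMap (T₂ t)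
  map_zero := by rw [T₁.map_zero, T₂.map_zero]; rfl
  map_add s t := by rw [T₁.map_add, T₂.map_add]; rfl
  continuous_orbit f := (T₁.continuous_orbit f.1).prodMk (T₂.continuous_orbit f.2)

theorem prod_apply (T₁ : C0Semigroup 𝕜 E₁) (T₂ : C0Semigroup 𝕜 E₂) (t : ℝ≥0) (x : E₁ × E₂) :
    T₁.prod T₂ t x = (T₁ t x.1, T₂ t x.2) := rfl

theorem mem_graph_generator_prod (T₁ : C0Semigroup 𝕜 E₁) (T₂ : C0Semigroup 𝕜 E₂)
    (f g : E₁ × E₂) : (f, g) ∈ (T₁.prod T₂).generator.graph ↔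
      (f.1, g.1) ∈ T₁.generator.graph ∧ (f.2, g.2) ∈ T₂.generator.graph := by
  rw [mem_graph_generator, mem_graph_generator, mem_graph_generator, Prod.tendsto_iff]
  rfl

theorem mem_graph_coupledOperator (A₁ : E₁ →ₗ.[𝕜] E₁) (A₂ : E₂ →ₗ.[𝕜] E₂)
    (B₁₂ : E₂ →L[𝕜] E₁) (B₂₁ : E₁ →L[𝕜] E₂) (f g : E₁ × E₂) :
    (f, g) ∈ (coupledOperator A₁ A₂ B₁₂ B₂₁).graph ↔
      (f.1, g.1 - B₁₂ f.2) ∈ A₁.graph ∧ (f.2, g.2 - B₂₁ f.1) ∈ A₂.graph := by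
  simp only [LinearPMap.mem_graph_iff]
  constructor
  · rintro ⟨y, rfl, rfl⟩
    refine ⟨⟨⟨y.1.1, y.2.1⟩, rfl, ?_⟩, ⟨⟨y.1.2, y.2.2⟩, rfl, ?_⟩⟩
    · exact (add_sub_cancel_right _ _).symm
    · exact (add_sub_cancel_left _ _).symm
  · rintro ⟨⟨y₁, h₁, e₁⟩, ⟨y₂, h₂, e₂⟩⟩
    have m₁ : f.1 ∈ A₁.domain := h₁ ▸ y₁.2
    have m₂ : f.2 ∈ A₂.domain := h₂ ▸ y₂.2
    obtain rfl : y₁ = ⟨f.1, m₁⟩ := Subtype.ext h₁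
    obtain rfl : y₂ = ⟨f.2, m₂⟩ := Subtype.ext h₂
    refine ⟨⟨f, m₁, m₂⟩, rfl, Prod.ext ?_ ?_⟩
    · exact eq_sub_iff_add_eq.1 e₁
    · exact (add_comm _ _).trans (eq_sub_iff_add_eq.1 e₂)

/-- The quotients of `S` and of the diagonal semigroup differ by a term that converges at every
vector, so they converge at the same vectors. -/
theorem generator_eq_coupledOperator {T₁ : C0Semigroup 𝕜 E₁} {T₂ : C0Semigroup 𝕜 E₂}
    {B₁₂ : E₂ →L[𝕜] E₁} {B₂₁ : E₁ →L[𝕜] E₂} {S : C0Semigroup 𝕜 (E₁ × E₂)}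
    (hS : ∀ x : E₁ × E₂, Tendsto (fun h : ℝ≥0 => (((h : ℝ) : 𝕜))⁻¹ • (S h x - T₁.prod T₂ h x))
      (𝓝[>] 0) (𝓝 (B₁₂ x.2, B₂₁ x.1))) :
    S.generator = coupledOperator T₁.generator T₂.generator B₁₂ B₂₁ := by
  refine LinearPMap.eq_of_eq_graph (Submodule.ext ?_)
  rintro ⟨f, g⟩
  have hT := mem_graph_generator_prod T₁ T₂ f (g - (B₁₂ f.2, B₂₁ f.1))
  rw [Prod.fst_sub, Prod.snd_sub] at hT
  rw [mem_graph_coupledOperator, ← hT, mem_graph_generator, mem_graph_generator]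
  constructor
  · intro h
    refine (h.sub (hS f)).congr fun r => ?_
    rw [← smul_sub]; congr 1; abel
  · intro h
    have := h.add (hS f)
    rw [sub_add_cancel] at this
    refine this.congr fun r => ?_
    rw [← smul_add]; congr 1; abel

end Product

end C0Semigroup

/-! ### Moduli, cones and ideals in Banach lattices -/

namespace BanachLatticeOver

section RealLattice

theorem add_inf_le_inf_add_inf {X : Type*} [AddCommGroup X] [Lattice X] [IsOrderedAddMonoid X]
    {a b x : X} (ha : 0 ≤ a) (hb : 0 ≤ b) (hx : 0 ≤ x) : (a + b) ⊓ x ≤ a ⊓ x + b ⊓ x := by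
  rw [add_inf, inf_add, inf_add]
  refine le_inf (le_inf inf_le_left ?_) (le_inf ?_ ?_)
  · exact inf_le_right.trans (le_add_of_nonneg_right hb)
  · exact inf_le_right.trans (le_add_of_nonneg_left ha)
  · exact inf_le_right.trans (le_add_of_nonneg_left hx)

variable {X : Type*} [NormedAddCommGroup X] [NormedSpace ℝ X] [Lattice X]
  [IsOrderedAddMonoid X] [IsOrderedModule ℝ X]

theorem smul_le_abs {r : ℝ} (hr : |r| ≤ 1) (x : X) : r • x ≤ |x| := by
  have h := abs_le.1 hr
  have e : r • x = ((1 + r) / 2) • x + ((1 - r) / 2) • (-x) := by module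
  have e' : |x| = ((1 + r) / 2) • |x| + ((1 - r) / 2) • |x| := by module
  rw [e, e']
  exact add_le_add (smul_le_smul_of_nonneg_left (le_abs_self x) (by linarith [h.1]))
    (smul_le_smul_of_nonneg_left (neg_le_abs x) (by linarith [h.2]))

theorem smul_inf_eq_zero {a x : X} (ha : 0 ≤ a) (hx : 0 ≤ x) (h : a ⊓ x = 0) {r : ℝ}
    (hr : 0 ≤ r) : (r • a) ⊓ x = 0 := by
  refine le_antisymm ?_ (le_inf (smul_nonneg hr ha) hx)
  have hR : 0 < r + 1 := by linarith
  have key : (r + 1)⁻¹ • ((r • a) ⊓ x) ≤ a ⊓ x := by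
    refine le_inf ?_ ?_
    · calc _ ≤ (r + 1)⁻¹ • (r • a) := smul_le_smul_of_nonneg_left inf_le_left (by positivity)
        _ = ((r + 1)⁻¹ * r) • a := smul_smul _ _ _
        _ ≤ (1 : ℝ) • a := smul_le_smul_of_nonneg_right
            (by rw [inv_mul_le_iff₀ hR]; linarith) ha
        _ = a := one_smul _ _
    · calc _ ≤ (r + 1)⁻¹ • x := smul_le_smul_of_nonneg_left inf_le_right (by positivity)
        _ ≤ (1 : ℝ) • x := smul_le_smul_of_nonneg_right
            (inv_le_one_of_one_le₀ (by linarith)) hx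
        _ = x := one_smul _ _
  rw [h] at key
  have := smul_le_smul_of_nonneg_left key hR.le
  rwa [smul_inv_smul₀ hR.ne', smul_zero] at this

/-- A totally ordered real Banach lattice is at most one-dimensional. -/
theorem exists_eq_smul_of_total [HasSolidNorm X] (hX : ∀ x : X, 0 ≤ x ∨ x ≤ 0) {g : X}
    (hg : 0 ≤ g) (hg0 : g ≠ 0) (x : X) : ∃ r : ℝ, x = r • g := by
  have hcont : Continuous fun r : ℝ => r • g := by fun_prop
  have hne : ∀ y : X, ∃ r : ℝ, y ≤ r • g := by
    intro y
    by_contra! hy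
    have hpos : 0 < ‖g‖ := norm_pos_iff.2 hg0
    -- Chosen so that `‖r • g‖ = ‖y‖ + 1`, contradicting `0 ≤ r • g ≤ y` and the solid norm.
    set r : ℝ := (‖y‖ + 1) / ‖g‖
    have hr : 0 ≤ r := by positivity
    have h1 : r • g ≤ y := by
      rcases hX (y - r • g) with h | h
      · exact sub_nonneg.1 h
      · exact absurd (sub_nonpos.1 h) (hy r)
    have h0 : 0 ≤ r • g := smul_nonneg hr hg
    have h2 : ‖r • g‖ ≤ ‖y‖ := norm_le_norm_of_abs_le_abs (by
      rwa [abs_of_nonneg h0, abs_of_nonneg (h0.trans h1)])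
    rw [norm_smul, Real.norm_of_nonneg hr, div_mul_cancel₀ _ hpos.ne'] at h2
    linarith
  -- The parameters with `r • g` above and below `x` form two nonempty closed sets covering `ℝ`; by
  -- connectedness they meet.
  obtain ⟨r, -, h1, h2⟩ := isPreconnected_closed_iff.1 (isPreconnected_univ (α := ℝ))
    {r | x ≤ r • g} {r | r • g ≤ x} (isClosed_le continuous_const hcont)
    (isClosed_le hcont continuous_const)
    (fun r _ => (hX (x - r • g)).elim (fun h => Or.inr (sub_nonneg.1 h))
      fun h => Or.inl (sub_nonpos.1 h))
    (by obtain ⟨r, hr⟩ := hne x; exact ⟨r, trivial, hr⟩)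
    (by
      obtain ⟨r, hr⟩ := hne (-x)
      refine ⟨-r, trivial, ?_⟩
      change (-r) • g ≤ x
      rw [neg_smul]; exact neg_le.1 hr)
  exact ⟨r, le_antisymm h1 h2⟩

end RealLattice

variable {𝕜 X E : Type*} [RCLike 𝕜]
  [NormedAddCommGroup X] [NormedSpace ℝ X] [CompleteSpace X] [Lattice X]
  [IsOrderedAddMonoid X] [IsOrderedModule ℝ X] [HasSolidNorm X]
  [NormedAddCommGroup E] [NormedSpace 𝕜 E] [BanachLatticeOver 𝕜 X E]

theorem re_smul_le_modulus (z : E) {c : 𝕜} (hc : ‖c‖ = 1) :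
    (re 𝕜 (c • z) : X) ≤ modulus 𝕜 z :=
  (isLUB_modulus z).1 ⟨c, hc, rfl⟩

theorem modulus_le {z : E} {x : X} (h : ∀ c : 𝕜, ‖c‖ = 1 → re 𝕜 (c • z) ≤ x) :
    modulus 𝕜 z ≤ x :=
  (isLUB_modulus z).2 (by rintro _ ⟨c, hc, rfl⟩; exact h c hc)

theorem re_ofReal_smul (r : ℝ) (z : E) : (re 𝕜 ((r : 𝕜) • z) : X) = r • re 𝕜 z := by
  obtain ⟨y, hy⟩ := exists_decomp (𝕜 := 𝕜) (X := X) z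
  conv_lhs => rw [hy]
  rw [smul_add, smul_comm, ← ofReal_smul, ← ofReal_smul, map_add, re_ofReal, re_I_smul_ofReal,
    add_zero]

theorem re_smul_ofReal (c : 𝕜) (x : X) :
    (re 𝕜 (c • (ofReal 𝕜 x : E)) : X) = RCLike.re c • x := by
  conv_lhs => rw [← RCLike.re_add_im c]
  rw [add_smul, mul_comm, mul_smul, ← ofReal_smul, ← ofReal_smul, map_add, re_ofReal,
    re_I_smul_ofReal, add_zero]

theorem eq_ofReal_re_add (z : E) :
    z = ofReal 𝕜 (re 𝕜 z : X) + (RCLike.I : 𝕜) • ofReal 𝕜 (re 𝕜 ((-RCLike.I : 𝕜) • z) : X) := by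
  obtain ⟨y, hy⟩ := exists_decomp (𝕜 := 𝕜) (X := X) z
  rcases RCLike.I_mul_I (K := 𝕜) with hI | hI
  · simpa [hI] using hy
  · have : (re 𝕜 ((-RCLike.I : 𝕜) • z) : X) = y := by
      rw [hy, smul_add, smul_smul, neg_mul, hI, neg_neg, one_smul, map_add, re_ofReal, neg_smul,
        map_neg, re_I_smul_ofReal, neg_zero, zero_add]
    rw [this]; exact hy

theorem abs_re_smul_le_modulus (z : E) {c : 𝕜} (hc : ‖c‖ = 1) :
    |(re 𝕜 (c • z) : X)| ≤ modulus 𝕜 z := by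
  refine abs_le'.2 ⟨re_smul_le_modulus z hc, ?_⟩
  rw [← map_neg, ← neg_smul]
  exact re_smul_le_modulus z (by rwa [norm_neg])

theorem abs_re_le_modulus (z : E) : |(re 𝕜 z : X)| ≤ modulus 𝕜 z := by
  simpa using abs_re_smul_le_modulus (X := X) z (c := (1 : 𝕜)) norm_one

theorem modulus_nonneg (z : E) : (0 : X) ≤ modulus 𝕜 z :=
  (abs_nonneg _).trans (abs_re_le_modulus z)

theorem modulus_ofReal (x : X) : (modulus 𝕜 (ofReal 𝕜 x : E) : X) = |x| := by
  refine le_antisymm (modulus_le fun c hc => ?_) ?_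
  · rw [re_smul_ofReal]
    exact smul_le_abs ((RCLike.abs_re_le_norm c).trans hc.le) x
  · have := abs_re_le_modulus (𝕜 := 𝕜) (X := X) (ofReal 𝕜 x : E)
    rwa [re_ofReal] at this

theorem modulus_add_le (z w : E) : (modulus 𝕜 (z + w) : X) ≤ modulus 𝕜 z + modulus 𝕜 w :=
  modulus_le fun c hc => by
    rw [smul_add, map_add]
    exact add_le_add (re_smul_le_modulus z hc) (re_smul_le_modulus w hc)

theorem modulus_smul_le (c : 𝕜) (z : E) : (modulus 𝕜 (c • z) : X) ≤ ‖c‖ • modulus 𝕜 z := by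
  refine modulus_le fun d hd => ?_
  rcases eq_or_ne c 0 with rfl | hc
  · simp
  have hc' : (‖c‖ : 𝕜) ≠ 0 := by simpa using hc
  -- The phase of `c` is absorbed into the unimodular scalar of the supremum, leaving only `‖c‖`.
  have e : d • c • z = (‖c‖ : 𝕜) • ((d * c * (‖c‖ : 𝕜)⁻¹) • z) := by
    rw [smul_smul, smul_smul]; congr 1; field_simp
  rw [e, re_ofReal_smul]
  refine smul_le_smul_of_nonneg_left (re_smul_le_modulus z ?_) (norm_nonneg c)
  rw [norm_mul, norm_mul, hd, one_mul, norm_inv, RCLike.norm_ofReal, abs_norm,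
    mul_inv_cancel₀ (norm_ne_zero_iff.2 hc)]

theorem modulus_neg (z : E) : (modulus 𝕜 (-z) : X) = modulus 𝕜 z := by
  have h : ∀ w : E, (modulus 𝕜 (-w) : X) ≤ modulus 𝕜 w := fun w => by
    simpa using modulus_smul_le (X := X) (-1 : 𝕜) w
  exact le_antisymm (h z) (by simpa using h (-z))

theorem modulus_zero : (modulus 𝕜 (0 : E) : X) = 0 :=
  norm_eq_zero.1 (by rw [norm_modulus, norm_zero])

theorem eq_zero_of_modulus_eq_zero {z : E} (h : (modulus 𝕜 z : X) = 0) : z = 0 := by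
  rw [← norm_eq_zero, ← norm_modulus (𝕜 := 𝕜) (X := X), h, norm_zero]

theorem abs_modulus_sub_le (z w : E) :
    |(modulus 𝕜 z - modulus 𝕜 w : X)| ≤ modulus 𝕜 (z - w) := by
  refine abs_le'.2 ⟨?_, ?_⟩
  · rw [sub_le_iff_le_add]
    simpa using modulus_add_le (𝕜 := 𝕜) (X := X) (z - w) w
  · rw [neg_sub, sub_le_iff_le_add, ← modulus_neg (z - w)]
    simpa using modulus_add_le (𝕜 := 𝕜) (X := X) (-(z - w)) z

theorem norm_le_norm_of_abs_le_modulus {x : X} {z : E} (h : |x| ≤ modulus 𝕜 z) :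
    ‖x‖ ≤ ‖z‖ := by
  rw [← norm_modulus (𝕜 := 𝕜) (X := X) z]
  exact norm_le_norm_of_abs_le_abs (by rwa [abs_of_nonneg (modulus_nonneg z)])

variable (𝕜 X E) in
theorem continuous_modulus : Continuous (modulus 𝕜 : E → X) := by
  refine (LipschitzWith.of_dist_le_mul (K := 1) fun z w => ?_).continuous
  rw [dist_eq_norm, dist_eq_norm, NNReal.coe_one, one_mul]
  exact norm_le_norm_of_abs_le_modulus (abs_modulus_sub_le z w)

variable (𝕜 X E) in
theorem continuous_re : Continuous (re 𝕜 : E →+ X) :=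
  AddMonoidHomClass.continuous_of_bound (re 𝕜 : E →+ X) 1 fun z => by
    rw [one_mul]; exact norm_le_norm_of_abs_le_modulus (abs_re_le_modulus (𝕜 := 𝕜) z)

variable (𝕜 E) in
theorem norm_ofReal (x : X) : ‖(ofReal 𝕜 x : E)‖ = ‖x‖ := by
  rw [← norm_modulus (𝕜 := 𝕜) (X := X), modulus_ofReal, norm_abs_eq_norm]

variable (𝕜 X E) in
theorem continuous_ofReal : Continuous (ofReal 𝕜 : X →+ E) :=
  AddMonoidHomClass.continuous_of_bound (ofReal 𝕜 : X →+ E) 1 fun x => by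
    rw [one_mul, norm_ofReal]

theorem ofReal_injective : Function.Injective (ofReal 𝕜 : X →+ E) := fun x y h => by
  rw [← re_ofReal (𝕜 := 𝕜) (E := E) x, h, re_ofReal]

theorem nonneg_ofReal {x : X} (hx : 0 ≤ x) : Nonneg 𝕜 X (ofReal 𝕜 x : E) := ⟨x, hx, rfl⟩

theorem nonneg_iff {z : E} : Nonneg 𝕜 X z ↔ (0 : X) ≤ re 𝕜 z ∧ ofReal 𝕜 (re 𝕜 z : X) = z := by
  constructor
  · rintro ⟨x, hx, rfl⟩
    rw [re_ofReal]; exact ⟨hx, rfl⟩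
  · rintro ⟨h, e⟩; exact ⟨_, h, e⟩

variable (𝕜 X E) in
theorem isClosed_setOf_nonneg : IsClosed {z : E | Nonneg 𝕜 X z} := by
  simp only [nonneg_iff, Set.ofPred_and]
  exact (isClosed_le continuous_const (continuous_re 𝕜 X E)).inter
    (isClosed_eq ((continuous_ofReal 𝕜 X E).comp (continuous_re 𝕜 X E)) continuous_id)

theorem Nonneg.add {z w : E} (hz : Nonneg 𝕜 X z) (hw : Nonneg 𝕜 X w) : Nonneg 𝕜 X (z + w) := by
  obtain ⟨x, hx, rfl⟩ := hz
  obtain ⟨y, hy, rfl⟩ := hw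
  exact ⟨x + y, add_nonneg hx hy, map_add _ _ _⟩

variable (𝕜 X E) in
theorem nonneg_zero : Nonneg 𝕜 X (0 : E) := ⟨0, le_rfl, map_zero _⟩

variable (𝕜 X E) in
/-- The positive cone. -/
def positiveCone [NormedSpace ℝ E] [IsScalarTower ℝ 𝕜 E] : Submodule ℝ≥0 E where
  carrier := {z | Nonneg 𝕜 X z}
  zero_mem' := nonneg_zero 𝕜 X E
  add_mem' := Nonneg.add
  smul_mem' := by
    rintro c _ ⟨x, hx, rfl⟩
    refine ⟨(c : ℝ) • x, smul_nonneg c.2 hx, ?_⟩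
    rw [ofReal_smul, ← RCLike.real_smul_eq_coe_smul, NNReal.smul_def]

theorem Nonneg.modulus_eq {z : E} (hz : Nonneg 𝕜 X z) : ofReal 𝕜 (modulus 𝕜 z : X) = z := by
  obtain ⟨x, hx, rfl⟩ := hz
  rw [modulus_ofReal, abs_of_nonneg hx]

theorem Nonneg.modulus_le_of_sub {z w : E} (hz : Nonneg 𝕜 X z) (hw : Nonneg 𝕜 X (w - z)) :
    (modulus 𝕜 z : X) ≤ modulus 𝕜 w := by
  obtain ⟨x, hx, rfl⟩ := hz
  obtain ⟨y, hy, h⟩ := hw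
  obtain rfl : w = ofReal 𝕜 (y + x) := by rw [map_add, h, sub_add_cancel]
  rw [modulus_ofReal, modulus_ofReal, abs_of_nonneg hx, abs_of_nonneg (add_nonneg hy hx)]
  exact le_add_of_nonneg_left hy

theorem Nonneg.eq_zero_of_neg {z : E} (hz : Nonneg 𝕜 X z) (hz' : Nonneg 𝕜 X (-z)) : z = 0 := by
  obtain ⟨x, hx, rfl⟩ := hz
  obtain ⟨y, hy, h⟩ := hz'
  rw [← map_neg] at h
  have := ofReal_injective h
  rw [le_antisymm (neg_nonneg.1 (this ▸ hy)) hx, map_zero]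

/-- An ideal is spanned by its positive elements. -/
theorem IsIdeal.le_of_nonneg_mem {I J : Submodule 𝕜 E} (hI : IsIdeal 𝕜 X I)
    (h : ∀ f ∈ I, Nonneg 𝕜 X f → f ∈ J) : I ≤ J := by
  have key : ∀ (x : X) (z : E), z ∈ I → |x| ≤ modulus 𝕜 z → (ofReal 𝕜 x : E) ∈ J := by
    intro x z hz hx
    have hp : ∀ y : X, 0 ≤ y → y ≤ |x| → (ofReal 𝕜 y : E) ∈ J := fun y hy hyx =>
      h _ (hI _ z (by rw [modulus_ofReal, abs_of_nonneg hy]; exact hyx.trans hx) hz)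
        (nonneg_ofReal hy)
    rw [← posPart_sub_negPart x, map_sub]
    exact J.sub_mem (hp _ (posPart_nonneg x) (sup_le (le_abs_self x) (abs_nonneg x)))
      (hp _ (negPart_nonneg x) (sup_le (neg_le_abs x) (abs_nonneg x)))
  intro z hz
  rw [eq_ofReal_re_add (𝕜 := 𝕜) (X := X) z]
  refine J.add_mem (key _ z hz (abs_re_le_modulus z)) ?_
  rcases RCLike.I_mul_I (K := 𝕜) with hI0 | hI1
  · rw [hI0, zero_smul]; exact J.zero_mem
  · refine J.smul_mem _ (key _ z hz (abs_re_smul_le_modulus z ?_))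
    have := congrArg norm hI1
    rw [norm_mul, norm_neg, norm_one] at this
    rw [norm_neg]
    nlinarith [norm_nonneg (RCLike.I : 𝕜)]

theorem isIdeal_top : IsIdeal 𝕜 X (⊤ : Submodule 𝕜 E) := fun _ _ _ _ => trivial

/-- The elements disjoint from a given positive element. -/
def disjointIdeal (𝕜 E : Type*) [RCLike 𝕜] [NormedAddCommGroup E] [NormedSpace 𝕜 E]
    [BanachLatticeOver 𝕜 X E] (x : X) (hx : 0 ≤ x) : Submodule 𝕜 E where
  carrier := {z | modulus 𝕜 z ⊓ x = 0}
  zero_mem' := by simp [modulus_zero, hx]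
  add_mem' {z w} hz hw := by
    refine le_antisymm ?_ (le_inf (modulus_nonneg _) hx)
    calc modulus 𝕜 (z + w) ⊓ x ≤ (modulus 𝕜 z + modulus 𝕜 w) ⊓ x :=
          inf_le_inf_right _ (modulus_add_le z w)
      _ ≤ modulus 𝕜 z ⊓ x + modulus 𝕜 w ⊓ x :=
          add_inf_le_inf_add_inf (modulus_nonneg z) (modulus_nonneg w) hx
      _ = 0 := by rw [show _ = _ from hz, show _ = _ from hw, add_zero]
  smul_mem' c z hz := by
    refine le_antisymm ?_ (le_inf (modulus_nonneg _) hx)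
    exact (inf_le_inf_right _ (modulus_smul_le c z)).trans
      (smul_inf_eq_zero (modulus_nonneg z) hx hz (norm_nonneg c)).le

theorem mem_disjointIdeal {x : X} {hx : 0 ≤ x} {z : E} :
    z ∈ disjointIdeal 𝕜 E x hx ↔ modulus 𝕜 z ⊓ x = 0 := Iff.rfl

theorem isClosed_disjointIdeal (x : X) (hx : 0 ≤ x) :
    IsClosed (disjointIdeal 𝕜 E x hx : Set E) :=
  isClosed_eq ((continuous_modulus 𝕜 X E).inf continuous_const) continuous_const

theorem isIdeal_disjointIdeal (x : X) (hx : 0 ≤ x) :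
    IsIdeal 𝕜 X (disjointIdeal 𝕜 E x hx) := fun _ _ h hg =>
  le_antisymm ((inf_le_inf_right _ h).trans (mem_disjointIdeal.1 hg).le)
    (le_inf (modulus_nonneg _) hx)

/-- A Banach lattice without non-trivial closed ideals is at most one-dimensional. -/
theorem exists_eq_smul_of_forall_ideal
    (h : ∀ I : Submodule 𝕜 E, IsClosed (I : Set E) → IsIdeal 𝕜 X I → I = ⊥ ∨ I = ⊤)
    {g : X} (hg : 0 ≤ g) (hg0 : g ≠ 0) (z : E) : ∃ c : 𝕜, z = c • ofReal 𝕜 g := by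
  have htot : ∀ x : X, 0 ≤ x ∨ x ≤ 0 := by
    intro x
    -- The disjoint complement of `x⁻` contains `x⁺`. If it is zero then `x⁺ = 0`; if it is
    -- everything then `x⁻` is disjoint from itself.
    have hd : x⁺ ⊓ x⁻ = 0 := posPart_inf_negPart_eq_zero x
    rcases h _ (isClosed_disjointIdeal (𝕜 := 𝕜) (E := E) x⁻ (negPart_nonneg x))
      (isIdeal_disjointIdeal _ _) with hI | hI
    · right
      have : (ofReal 𝕜 x⁺ : E) ∈ disjointIdeal 𝕜 E x⁻ (negPart_nonneg x) := by
        rw [mem_disjointIdeal, modulus_ofReal, abs_of_nonneg (posPart_nonneg x), hd]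
      rw [hI, Submodule.mem_bot, ← map_zero (ofReal 𝕜 : X →+ E)] at this
      exact posPart_eq_zero.1 (ofReal_injective this)
    · left
      have : (ofReal 𝕜 x⁻ : E) ∈ disjointIdeal 𝕜 E x⁻ (negPart_nonneg x) := by rw [hI]; trivial
      rw [mem_disjointIdeal, modulus_ofReal, abs_of_nonneg (negPart_nonneg x), inf_idem] at this
      exact negPart_eq_zero.1 this
  obtain ⟨r, hr⟩ := exists_eq_smul_of_total htot hg hg0 (re 𝕜 z)
  obtain ⟨s, hs⟩ := exists_eq_smul_of_total htot hg hg0 (re 𝕜 ((-RCLike.I : 𝕜) • z))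
  refine ⟨(r : 𝕜) + RCLike.I * s, ?_⟩
  conv_lhs => rw [eq_ofReal_re_add (𝕜 := 𝕜) (X := X) z, hr, hs]
  rw [ofReal_smul, ofReal_smul, add_smul, mul_smul]

end BanachLatticeOver

/-! ### Consequences of persistent irreducibility -/

namespace C0Semigroup

open BanachLatticeOver

section Lattice

variable {𝕜 X E : Type*} [RCLike 𝕜]
  [NormedAddCommGroup X] [NormedSpace ℝ X] [CompleteSpace X] [Lattice X]
  [IsOrderedAddMonoid X] [IsOrderedModule ℝ X] [HasSolidNorm X]
  [NormedAddCommGroup E] [NormedSpace 𝕜 E] [BanachLatticeOver 𝕜 X E]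

/-- A persistently irreducible semigroup on a non-zero Banach lattice is not nilpotent. -/
theorem PersistentlyIrreducible.eq_zero_of_nilpotent {T : C0Semigroup 𝕜 E}
    (hT : T.PersistentlyIrreducible X) {t₀ : ℝ≥0} (h : ∀ t ≥ t₀, ∀ f, T t f = 0) (f : E) :
    f = 0 := by
  -- Zero operators leave every ideal invariant, so no non-trivial closed ideals exist and `E` is
  -- one-dimensional.
  have hideal : ∀ I : Submodule 𝕜 E, IsClosed (I : Set E) → IsIdeal 𝕜 X I → I = ⊥ ∨ I = ⊤ :=
    fun I hc hI => hT I hc hI ⟨t₀, fun t ht f _ => by rw [h t ht f]; exact I.zero_mem⟩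
  by_contra hf
  set g : X := modulus 𝕜 f with hg
  have hg0 : g ≠ 0 := fun h0 => hf (eq_zero_of_modulus_eq_zero h0)
  have hspan := exists_eq_smul_of_forall_ideal hideal (modulus_nonneg f) hg0
  set e : E := ofReal 𝕜 g with he
  -- On a line, `T t e = c • e` gives `T (2 * t) e = c ^ 2 • e`, so a vanishing time can be halved.
  -- Strong continuity at `0` then forces `e = 0`.
  have hhalf : ∀ n : ℕ, T (t₀ / 2 ^ n) e = 0 := by
    intro n
    induction n with
    | zero => simpa using h t₀ le_rfl e
    | succ n ih =>
      obtain ⟨c, hc⟩ := hspan (T (t₀ / 2 ^ (n + 1)) e)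
      have e1 : t₀ / 2 ^ n = t₀ / 2 ^ (n + 1) + t₀ / 2 ^ (n + 1) := by
        rw [← add_div, pow_succ]; field_simp; ring
      rw [e1, apply_add, hc, _root_.map_smul, hc, smul_smul] at ih
      rcases smul_eq_zero.1 ih with h0 | h0
      · rw [hc, mul_self_eq_zero.1 h0, zero_smul]
      · rw [h0, _root_.map_zero]
  have hlim : Tendsto (fun n : ℕ => t₀ / 2 ^ n) atTop (𝓝 0) := by
    have : Tendsto (fun n : ℕ => t₀ * (2⁻¹ : ℝ≥0) ^ n) atTop (𝓝 (t₀ * 0)) :=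
      (NNReal.tendsto_pow_atTop_nhds_zero_of_lt_one (by
        rw [← NNReal.coe_lt_coe]; norm_num)).const_mul t₀
    simpa [div_eq_mul_inv] using this
  have h1 := ((T.continuous_orbit e).tendsto 0).comp hlim
  simp only [Function.comp_def, hhalf, apply_zero] at h1
  have h2 : e = 0 := tendsto_nhds_unique h1 tendsto_const_nhds
  rw [he, ← _root_.map_zero (ofReal 𝕜 : X →+ E)] at h2
  exact hg0 (ofReal_injective h2)

/-- The vectors that `T t` maps into `J` for all `t ≥ n`. -/
def absorbedSubmodule (T : C0Semigroup 𝕜 E) (J : Submodule 𝕜 E) (n : ℕ) : Submodule 𝕜 E where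
  carrier := {f | ∀ t : ℝ≥0, n ≤ t → T t f ∈ J}
  zero_mem' t _ := by rw [_root_.map_zero]; exact J.zero_mem
  add_mem' hf hg t ht := by rw [_root_.map_add]; exact J.add_mem (hf t ht) (hg t ht)
  smul_mem' c f hf t ht := by rw [_root_.map_smul]; exact J.smul_mem c (hf t ht)

/-- If every positive element of a closed ideal `I` is eventually mapped into the closed subspace
`J`, then all of `I` is mapped into `J` from some time on. -/
theorem exists_forall_mem_of_eventually_mem [CompleteSpace E] (T : C0Semigroup 𝕜 E) {I J : Submodule 𝕜 E}
    (hIc : IsClosed (I : Set E)) (hI : IsIdeal 𝕜 X I) (hJ : IsClosed (J : Set E))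
    (h : ∀ f ∈ I, Nonneg 𝕜 X f → ∃ t₀ : ℝ≥0, ∀ t ≥ t₀, T t f ∈ J) :
    ∃ t₀ : ℝ≥0, ∀ t ≥ t₀, ∀ f ∈ I, T t f ∈ J := by
  have hmono : Monotone (T.absorbedSubmodule J) := fun m n hmn f hf t ht =>
    hf t (le_trans (Nat.cast_le.2 hmn) ht)
  have hle : I ≤ ⨆ n, T.absorbedSubmodule J n := hI.le_of_nonneg_mem fun f hf hpos => by
    obtain ⟨t₀, ht₀⟩ := h f hf hpos
    obtain ⟨n, hn⟩ := exists_nat_ge t₀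
    exact Submodule.mem_iSup_of_mem n fun t ht => ht₀ t (hn.trans ht)
  have : CompleteSpace I := hIc.completeSpace_coe
  have hclosed : ∀ n, IsClosed ((T.absorbedSubmodule J n).comap I.subtype : Set I) := by
    intro n
    have e : ((T.absorbedSubmodule J n).comap I.subtype : Set I) =
        ⋂ (t : ℝ≥0) (_ : (n : ℝ≥0) ≤ t), {f : I | T t f ∈ J} := by
      ext f; simp [absorbedSubmodule]
    rw [e]
    exact isClosed_iInter fun t => isClosed_iInter fun _ =>
      hJ.preimage ((T t).continuous.comp continuous_subtype_val)
  -- Baire's theorem in the complete space `I`: one of the absorbed subspaces has interior, hence is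
  -- all of `I`.
  obtain ⟨n, hn⟩ := nonempty_interior_of_iUnion_of_closed hclosed (by
    refine Set.eq_univ_of_forall fun f => Set.mem_iUnion.2 ?_
    exact (Submodule.mem_iSup_of_directed _ hmono.directed_le).1 (hle f.2))
  have htop := Submodule.eq_top_of_nonempty_interior' _ hn
  refine ⟨n, fun t ht f hf => ?_⟩
  have : (⟨f, hf⟩ : I) ∈ (T.absorbedSubmodule J n).comap I.subtype := by rw [htop]; trivial
  exact this t ht

end Lattice

section Coupling

variable {𝕜 X E Y F : Type*} [RCLike 𝕜]
  [NormedAddCommGroup X] [NormedSpace ℝ X] [CompleteSpace X] [Lattice X]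
  [IsOrderedAddMonoid X] [IsOrderedModule ℝ X] [HasSolidNorm X]
  [NormedAddCommGroup E] [NormedSpace 𝕜 E] [BanachLatticeOver 𝕜 X E]
  [NormedAddCommGroup Y] [NormedSpace ℝ Y] [CompleteSpace Y] [Lattice Y]
  [IsOrderedAddMonoid Y] [IsOrderedModule ℝ Y] [HasSolidNorm Y]
  [NormedAddCommGroup F] [NormedSpace 𝕜 F] [BanachLatticeOver 𝕜 Y F]

/-- Both `B f` and `B g - B f = -B f` are positive, and the cone contains no line. -/
theorem _root_.BanachLatticeOver.IsPositiveOperator.apply_eq_zero_of_le {B : E →L[𝕜] F}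
    (hB : IsPositiveOperator X Y B) {f g : E} (hf : Nonneg 𝕜 X f) (hfg : Nonneg 𝕜 X (g - f))
    (hg : B g = 0) : B f = 0 := by
  refine (hB f hf).eq_zero_of_neg ?_
  have := hB _ hfg
  rwa [_root_.map_sub, hg, zero_sub] at this

/-- The absolute kernel `{f | B |f| = 0}` of a positive operator. -/
def absKernel (B : E →L[𝕜] F) (hB : IsPositiveOperator X Y B) : Submodule 𝕜 E where
  carrier := {f | B (ofReal 𝕜 (modulus 𝕜 f : X)) = 0}
  zero_mem' := by simp [modulus_zero]
  add_mem' {f g} hf hg := by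
    refine hB.apply_eq_zero_of_le (g := ofReal 𝕜 (modulus 𝕜 f + modulus 𝕜 g : X))
      (nonneg_ofReal (modulus_nonneg _)) ?_ ?_
    · rw [← _root_.map_sub]
      exact nonneg_ofReal (sub_nonneg.2 (modulus_add_le f g))
    · rw [_root_.map_add, _root_.map_add, show _ = _ from hf, show _ = _ from hg, add_zero]
  smul_mem' c f hf := by
    refine hB.apply_eq_zero_of_le (g := ofReal 𝕜 (‖c‖ • modulus 𝕜 f : X))
      (nonneg_ofReal (modulus_nonneg _)) ?_ ?_
    · rw [← _root_.map_sub]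
      exact nonneg_ofReal (sub_nonneg.2 (modulus_smul_le c f))
    · rw [ofReal_smul, _root_.map_smul, show _ = _ from hf, smul_zero]

theorem mem_absKernel {B : E →L[𝕜] F} {hB : IsPositiveOperator X Y B} {f : E} :
    f ∈ absKernel B hB ↔ B (ofReal 𝕜 (modulus 𝕜 f : X)) = 0 := Iff.rfl

theorem isClosed_absKernel (B : E →L[𝕜] F) (hB : IsPositiveOperator X Y B) :
    IsClosed (absKernel B hB : Set E) :=
  isClosed_eq (B.continuous.comp ((continuous_ofReal 𝕜 X E).comp (continuous_modulus 𝕜 X E)))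
    continuous_const

theorem isIdeal_absKernel (B : E →L[𝕜] F) (hB : IsPositiveOperator X Y B) :
    IsIdeal 𝕜 X (absKernel B hB) := fun f g h hg =>
  hB.apply_eq_zero_of_le (g := ofReal 𝕜 (modulus 𝕜 g : X)) (nonneg_ofReal (modulus_nonneg f))
    (by rw [← _root_.map_sub]; exact nonneg_ofReal (sub_nonneg.2 h)) hg

/-- A positive operator that eventually annihilates every positive orbit of a persistently
irreducible, individually eventually positive semigroup is zero. -/
theorem PersistentlyIrreducible.eq_zero_of_eventually_apply_eq_zero [CompleteSpace E]
    {T : C0Semigroup 𝕜 E} (hT : T.PersistentlyIrreducible X)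
    (hpos : T.IndividuallyEventuallyPositive X) {B : E →L[𝕜] F} (hB : IsPositiveOperator X Y B)
    (h : ∀ f, Nonneg 𝕜 X f → ∃ t₀ : ℝ≥0, ∀ t ≥ t₀, B (T t f) = 0) : B = 0 := by
  obtain ⟨t₀, ht₀⟩ := T.exists_forall_mem_of_eventually_mem (X := X) (I := ⊤)
    (J := absKernel B hB) isClosed_univ isIdeal_top (isClosed_absKernel B hB) fun f _ hf => by
      obtain ⟨t₁, h₁⟩ := h f hf
      obtain ⟨t₂, h₂⟩ := hpos f hf
      refine ⟨max t₁ t₂, fun t ht => ?_⟩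
      rw [mem_absKernel, (h₂ t (le_of_max_le_right ht)).modulus_eq]
      exact h₁ t (le_of_max_le_left ht)
  -- The whole space is eventually mapped into the kernel, which is therefore invariant. If it is
  -- zero, `T` is nilpotent and `E` is zero; otherwise `B` kills every positive vector.
  rcases hT _ (isClosed_absKernel B hB) (isIdeal_absKernel B hB)
    ⟨t₀, fun t ht f _ => ht₀ t ht f trivial⟩ with hN | hN
  · ext f
    rw [hT.eq_zero_of_nilpotent (t₀ := t₀) (fun t ht f => by
      have := ht₀ t ht f trivial
      rwa [hN, Submodule.mem_bot] at this) f, _root_.map_zero, _root_.map_zero]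
  · have hle : (⊤ : Submodule 𝕜 E) ≤ LinearMap.ker B.toLinearMap :=
      (isIdeal_top (X := X)).le_of_nonneg_mem fun f _ hf => by
        have : f ∈ absKernel B hB := by rw [hN]; trivial
        rw [mem_absKernel, hf.modulus_eq] at this
        exact this
    ext f
    exact hle (Submodule.mem_top (x := f))

end Coupling

end C0Semigroup

/-! ### The coupled semigroup and its invariant ideals -/

namespace C0Semigroup

open BanachLatticeOver

variable {𝕜 X₁ E₁ X₂ E₂ : Type*} [RCLike 𝕜]
  [NormedAddCommGroup X₁] [NormedSpace ℝ X₁] [CompleteSpace X₁] [Lattice X₁]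
  [IsOrderedAddMonoid X₁] [IsOrderedModule ℝ X₁] [HasSolidNorm X₁]
  [NormedAddCommGroup E₁] [NormedSpace 𝕜 E₁] [BanachLatticeOver 𝕜 X₁ E₁]
  [NormedAddCommGroup X₂] [NormedSpace ℝ X₂] [CompleteSpace X₂] [Lattice X₂]
  [IsOrderedAddMonoid X₂] [IsOrderedModule ℝ X₂] [HasSolidNorm X₂]
  [NormedAddCommGroup E₂] [NormedSpace 𝕜 E₂] [BanachLatticeOver 𝕜 X₂ E₂]

theorem _root_.BanachLatticeOver.nonneg_prod_iff {f : E₁ × E₂} :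
    Nonneg 𝕜 (X₁ × X₂) f ↔ Nonneg 𝕜 X₁ f.1 ∧ Nonneg 𝕜 X₂ f.2 := by
  constructor
  · rintro ⟨x, hx, rfl⟩
    exact ⟨⟨x.1, hx.1, rfl⟩, ⟨x.2, hx.2, rfl⟩⟩
  · rintro ⟨⟨x, hx, h₁⟩, ⟨y, hy, h₂⟩⟩
    exact ⟨(x, y), ⟨hx, hy⟩, Prod.ext h₁ h₂⟩

variable [CompleteSpace E₁] [CompleteSpace E₂]

theorem exists_coupled_semigroup (T₁ : C0Semigroup 𝕜 E₁) (T₂ : C0Semigroup 𝕜 E₂)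
    (B₁₂ : E₂ →L[𝕜] E₁) (B₂₁ : E₁ →L[𝕜] E₂)
    (h₁₂ : ∀ s t : ℝ≥0, IsPositiveOperator X₂ X₁ ((T₁ t).comp (B₁₂.comp (T₂ s))))
    (h₂₁ : ∀ s t : ℝ≥0, IsPositiveOperator X₁ X₂ ((T₂ t).comp (B₂₁.comp (T₁ s)))) :
    ∃ S : C0Semigroup 𝕜 (E₁ × E₂),
      (∀ x : E₁ × E₂, Tendsto (fun h : ℝ≥0 => (((h : ℝ) : 𝕜))⁻¹ • (S h x - T₁.prod T₂ h x))
        (𝓝[>] 0) (𝓝 (B₁₂ x.2, B₂₁ x.1))) ∧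
      ∀ t x, Nonneg 𝕜 (X₁ × X₂) x → Nonneg 𝕜 (X₁ × X₂) (S t x - T₁.prod T₂ t x) := by
  let _ : NormedSpace ℝ (E₁ × E₂) := NormedSpace.restrictScalars ℝ 𝕜 (E₁ × E₂)
  have : IsScalarTower ℝ 𝕜 (E₁ × E₂) := ⟨fun r c x => by
    rw [Algebra.smul_def, mul_smul]; rfl⟩
  obtain ⟨S, hS, hK⟩ := (T₁.prod T₂).exists_perturbation
    ((B₁₂.comp (ContinuousLinearMap.snd 𝕜 E₁ E₂)).prod
      (B₂₁.comp (ContinuousLinearMap.fst 𝕜 E₁ E₂)))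
  have key : ∀ t s, ∀ x : E₁ × E₂, Nonneg 𝕜 (X₁ × X₂) x → Nonneg 𝕜 (X₁ × X₂)
      (T₁ t (B₁₂ (T₂ s x.2)), T₂ t (B₂₁ (T₁ s x.1))) := fun t s x hx =>
    nonneg_prod_iff.2 ⟨h₁₂ s t _ (nonneg_prod_iff.1 hx).2, h₂₁ s t _ (nonneg_prod_iff.1 hx).1⟩
  refine ⟨S, hS, hK (positiveCone 𝕜 (X₁ × X₂) (E₁ × E₂)) (isClosed_setOf_nonneg 𝕜 _ _)
    (fun t x hx => ?_) key⟩
  -- Taking `s = 0` gives positivity of `T t B`, which keeps the later series terms in the cone.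
  have := key t 0 x hx
  rwa [apply_zero, apply_zero] at this

variable {T₁ : C0Semigroup 𝕜 E₁} {T₂ : C0Semigroup 𝕜 E₂} {S : C0Semigroup 𝕜 (E₁ × E₂)}

theorem persistentlyIrreducible_of_coupled {B₁₂ : E₂ →L[𝕜] E₁} {B₂₁ : E₁ →L[𝕜] E₂}
    (hlim : ∀ x : E₁ × E₂, Tendsto (fun h : ℝ≥0 => (((h : ℝ) : 𝕜))⁻¹ • (S h x - T₁.prod T₂ h x))
      (𝓝[>] 0) (𝓝 (B₁₂ x.2, B₂₁ x.1)))
    (hpos : ∀ t x, Nonneg 𝕜 (X₁ × X₂) x → Nonneg 𝕜 (X₁ × X₂) (S t x - T₁.prod T₂ t x))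
    (hB₁₂ : IsPositiveOperator X₂ X₁ B₁₂) (hB₂₁ : IsPositiveOperator X₁ X₂ B₂₁)
    (hT₁ : T₁.IndividuallyEventuallyPositive X₁) (hT₂ : T₂.IndividuallyEventuallyPositive X₂)
    (hI₁ : T₁.PersistentlyIrreducible X₁) (hI₂ : T₂.PersistentlyIrreducible X₂)
    (h₁₂ : B₁₂ ≠ 0) (h₂₁ : B₂₁ ≠ 0) : S.PersistentlyIrreducible (X₁ × X₂) := by
  rintro I hIc hI ⟨t₀, ht₀⟩
  have mem_of_modulus_le : ∀ {f g : E₁ × E₂}, (modulus 𝕜 f.1 : X₁) ≤ modulus 𝕜 g.1 →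
      (modulus 𝕜 f.2 : X₂) ≤ modulus 𝕜 g.2 → g ∈ I → f ∈ I :=
    fun {f g} h h' hg => hI f g ⟨h, h'⟩ hg
  set I₁ : Submodule 𝕜 E₁ := I.comap (LinearMap.inl 𝕜 E₁ E₂) with hI₁def
  set I₂ : Submodule 𝕜 E₂ := I.comap (LinearMap.inr 𝕜 E₁ E₂) with hI₂def
  have mem₁ : ∀ f, f ∈ I₁ ↔ (f, (0 : E₂)) ∈ I := fun _ => Iff.rfl
  have mem₂ : ∀ f, f ∈ I₂ ↔ ((0 : E₁), f) ∈ I := fun _ => Iff.rfl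
  have hc₁ : IsClosed (I₁ : Set E₁) := hIc.preimage (ContinuousLinearMap.inl 𝕜 E₁ E₂).continuous
  have hc₂ : IsClosed (I₂ : Set E₂) := hIc.preimage (ContinuousLinearMap.inr 𝕜 E₁ E₂).continuous
  have id₁ : IsIdeal 𝕜 X₁ I₁ := fun f g h hg => hI (f, 0) (g, 0) ⟨h, le_rfl⟩ hg
  have id₂ : IsIdeal 𝕜 X₂ I₂ := fun f g h hg => hI (0, f) (0, g) ⟨le_rfl, h⟩ hg
  -- An ideal of the product is determined by its sections: `(f.1, 0)` has smaller modulus than `f`.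
  have fst_mem : ∀ f ∈ I, f.1 ∈ I₁ := fun f hf =>
    mem_of_modulus_le (g := f) le_rfl (by simpa [modulus_zero] using modulus_nonneg f.2) hf
  have snd_mem : ∀ f ∈ I, f.2 ∈ I₂ := fun f hf =>
    mem_of_modulus_le (g := f) (by simpa [modulus_zero] using modulus_nonneg f.1) le_rfl hf
  -- Once the diagonal orbit is positive it is dominated by the `S`-orbit, which lies in `I`.
  have diag_mem : ∀ f ∈ I, Nonneg 𝕜 (X₁ × X₂) f → ∀ t ≥ t₀,
      Nonneg 𝕜 (X₁ × X₂) (T₁.prod T₂ t f) → T₁.prod T₂ t f ∈ I := fun f hf hf' t ht h =>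
    hI _ _ (h.modulus_le_of_sub (hpos t f hf')) (ht₀ t ht f hf)
  have triv₁ : I₁ = ⊥ ∨ I₁ = ⊤ := hI₁ I₁ hc₁ id₁ <|
    T₁.exists_forall_mem_of_eventually_mem (X := X₁) hc₁ id₁ hc₁ fun f hf hf' => by
      obtain ⟨t₁, ht₁⟩ := hT₁ f hf'
      refine ⟨max t₀ t₁, fun t ht => fst_mem _ (diag_mem (f, 0) hf
        (nonneg_prod_iff.2 ⟨hf', nonneg_zero 𝕜 X₂ E₂⟩) t (le_of_max_le_left ht)
        (nonneg_prod_iff.2 ⟨ht₁ t (le_of_max_le_right ht), ?_⟩))⟩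
      rw [prod_apply, _root_.map_zero]; exact nonneg_zero 𝕜 X₂ E₂
  have triv₂ : I₂ = ⊥ ∨ I₂ = ⊤ := hI₂ I₂ hc₂ id₂ <|
    T₂.exists_forall_mem_of_eventually_mem (X := X₂) hc₂ id₂ hc₂ fun f hf hf' => by
      obtain ⟨t₁, ht₁⟩ := hT₂ f hf'
      refine ⟨max t₀ t₁, fun t ht => snd_mem _ (diag_mem (0, f) hf
        (nonneg_prod_iff.2 ⟨nonneg_zero 𝕜 X₁ E₁, hf'⟩) t (le_of_max_le_left ht)
        (nonneg_prod_iff.2 ⟨?_, ht₁ t (le_of_max_le_right ht)⟩))⟩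
      rw [prod_apply, _root_.map_zero]; exact nonneg_zero 𝕜 X₁ E₁
  -- Invariance is known only from `t₀` on. Starting at `S t f` with `t ≥ t₀` permits every `h ≥ 0`,
  -- hence a derivative at `h = 0`.
  have orbit_mem : ∀ f ∈ I, ∀ t ≥ t₀, ∀ h : ℝ≥0, S h (S t f) ∈ I := fun f hf t ht h => by
    rw [← apply_add]; exact ht₀ _ (ht.trans le_add_self) f hf
  rcases triv₁ with e₁ | e₁ <;> rcases triv₂ with e₂ | e₂
  · left
    refine (Submodule.eq_bot_iff _).2 fun f hf => Prod.ext ?_ ?_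
    · have := fst_mem f hf; rwa [e₁] at this
    · have := snd_mem f hf; rwa [e₂] at this
  -- Here `I = {0} × E₂`. The first component of the quotient in `hlim` vanishes identically along
  -- the orbit, while its limit is `B₁₂ (S t (0, f)).2`.
  · refine absurd (hI₂.eq_zero_of_eventually_apply_eq_zero hT₂ hB₁₂ fun f hf => ?_) h₁₂
    have hfst : ∀ f ∈ I, f.1 = 0 := fun f hf => by
      have := fst_mem f hf; rwa [e₁] at this
    have hfI : ((0 : E₁), f) ∈ I := (mem₂ f).1 (e₂ ▸ Submodule.mem_top)
    obtain ⟨t₁, ht₁⟩ := hT₂ f hf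
    refine ⟨max t₀ t₁, fun t ht => hB₁₂.apply_eq_zero_of_le (g := (S t (0, f)).2)
      (ht₁ t (le_of_max_le_right ht))
      (nonneg_prod_iff.1 (hpos t (0, f) (nonneg_prod_iff.2 ⟨nonneg_zero 𝕜 X₁ E₁, hf⟩))).2 ?_⟩
    have horb := orbit_mem _ hfI t (le_of_max_le_left ht)
    refine tendsto_nhds_unique ((continuous_fst.tendsto _).comp (hlim (S t (0, f))))
      (tendsto_const_nhds.congr fun h => ?_)
    have h0 := hfst _ (horb 0)
    rw [apply_zero] at h0
    simp only [Function.comp_apply, Prod.smul_fst, Prod.fst_sub, prod_apply, h0,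
      hfst _ (horb h), _root_.map_zero, sub_zero, smul_zero]
  · refine absurd (hI₁.eq_zero_of_eventually_apply_eq_zero hT₁ hB₂₁ fun f hf => ?_) h₂₁
    have hsnd : ∀ f ∈ I, f.2 = 0 := fun f hf => by
      have := snd_mem f hf; rwa [e₂] at this
    have hfI : (f, (0 : E₂)) ∈ I := (mem₁ f).1 (e₁ ▸ Submodule.mem_top)
    obtain ⟨t₁, ht₁⟩ := hT₁ f hf
    refine ⟨max t₀ t₁, fun t ht => hB₂₁.apply_eq_zero_of_le (g := (S t (f, 0)).1)
      (ht₁ t (le_of_max_le_right ht))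
      (nonneg_prod_iff.1 (hpos t (f, 0) (nonneg_prod_iff.2 ⟨hf, nonneg_zero 𝕜 X₂ E₂⟩))).1 ?_⟩
    have horb := orbit_mem _ hfI t (le_of_max_le_left ht)
    refine tendsto_nhds_unique ((continuous_snd.tendsto _).comp (hlim (S t (f, 0))))
      (tendsto_const_nhds.congr fun h => ?_)
    have h0 := hsnd _ (horb 0)
    rw [apply_zero] at h0
    simp only [Function.comp_apply, Prod.smul_snd, Prod.snd_sub, prod_apply, h0,
      hsnd _ (horb h), _root_.map_zero, sub_zero, smul_zero]
  · right
    refine Submodule.eq_top_iff'.2 fun f => ?_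
    have h₁ : (f.1, (0 : E₂)) ∈ I := (mem₁ f.1).1 (e₁ ▸ Submodule.mem_top)
    have h₂ : ((0 : E₁), f.2) ∈ I := (mem₂ f.2).1 (e₂ ▸ Submodule.mem_top)
    simpa using I.add_mem h₁ h₂

end C0Semigroup

end

/-! ### Assembly of the theorem -/

theorem mainTheorem7 {𝕜 X₁ E₁ X₂ E₂ : Type*} [RCLike 𝕜]
    [NormedAddCommGroup X₁] [NormedSpace ℝ X₁] [CompleteSpace X₁] [Lattice X₁]
    [IsOrderedAddMonoid X₁] [IsOrderedModule ℝ X₁] [HasSolidNorm X₁]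
    [NormedAddCommGroup E₁] [NormedSpace 𝕜 E₁] [CompleteSpace E₁] [BanachLatticeOver 𝕜 X₁ E₁]
    [NormedAddCommGroup X₂] [NormedSpace ℝ X₂] [CompleteSpace X₂] [Lattice X₂]
    [IsOrderedAddMonoid X₂] [IsOrderedModule ℝ X₂] [HasSolidNorm X₂]
    [NormedAddCommGroup E₂] [NormedSpace 𝕜 E₂] [CompleteSpace E₂] [BanachLatticeOver 𝕜 X₂ E₂]
    (T₁ : C0Semigroup 𝕜 E₁) (T₂ : C0Semigroup 𝕜 E₂)
    (B₁₂ : E₂ →L[𝕜] E₁) (B₂₁ : E₁ →L[𝕜] E₂)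
    (h₁₂ : ∀ s t : NNReal,
      BanachLatticeOver.IsPositiveOperator X₂ X₁ ((T₁ t).comp (B₁₂.comp (T₂ s))))
    (h₂₁ : ∀ s t : NNReal,
      BanachLatticeOver.IsPositiveOperator X₁ X₂ ((T₂ t).comp (B₂₁.comp (T₁ s)))) :
    (∃! S : C0Semigroup 𝕜 (E₁ × E₂),
      S.generator = coupledOperator T₁.generator T₂.generator B₁₂ B₂₁) ∧
    ∀ S : C0Semigroup 𝕜 (E₁ × E₂),
      S.generator = coupledOperator T₁.generator T₂.generator B₁₂ B₂₁ →
      (T₁.IndividuallyEventuallyPositive X₁ → T₂.IndividuallyEventuallyPositive X₂ →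
        S.IndividuallyEventuallyPositive (X₁ × X₂)) ∧
      (T₁.UniformlyEventuallyPositive X₁ → T₂.UniformlyEventuallyPositive X₂ →
        S.UniformlyEventuallyPositive (X₁ × X₂)) ∧
      (T₁.IndividuallyEventuallyPositive X₁ → T₂.IndividuallyEventuallyPositive X₂ →
        T₁.PersistentlyIrreducible X₁ → T₂.PersistentlyIrreducible X₂ →
        B₁₂ ≠ 0 → B₂₁ ≠ 0 → S.PersistentlyIrreducible (X₁ × X₂)) := by
  obtain ⟨S₀, hlim, hpos⟩ := C0Semigroup.exists_coupled_semigroup T₁ T₂ B₁₂ B₂₁ h₁₂ h₂₁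
  have hgen := C0Semigroup.generator_eq_coupledOperator hlim
  let _ : NormedSpace ℝ (E₁ × E₂) := NormedSpace.restrictScalars ℝ 𝕜 (E₁ × E₂)
  have : IsScalarTower ℝ 𝕜 (E₁ × E₂) := ⟨fun r c x => by
    rw [Algebra.smul_def, mul_smul]; rfl⟩
  have huniq : ∀ S : C0Semigroup 𝕜 (E₁ × E₂),
      S.generator = coupledOperator T₁.generator T₂.generator B₁₂ B₂₁ → S = S₀ :=
    fun S hS => C0Semigroup.eq_of_generator_eq (hS.trans hgen.symm)
  have hnonneg : ∀ t f, BanachLatticeOver.Nonneg 𝕜 (X₁ × X₂) f →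
      BanachLatticeOver.Nonneg 𝕜 X₁ (T₁ t f.1) → BanachLatticeOver.Nonneg 𝕜 X₂ (T₂ t f.2) →
      BanachLatticeOver.Nonneg 𝕜 (X₁ × X₂) (S₀ t f) := fun t f hf h₁ h₂ => by
    have := (hpos t f hf).add (BanachLatticeOver.nonneg_prod_iff (f := T₁.prod T₂ t f).2 ⟨h₁, h₂⟩)
    rwa [sub_add_cancel] at this
  refine ⟨⟨S₀, hgen, huniq⟩, fun S hS => ?_⟩
  obtain rfl := huniq S hS
  refine ⟨fun hT₁ hT₂ f hf => ?_, ?_, fun hT₁ hT₂ hI₁ hI₂ hB₁₂ hB₂₁ => ?_⟩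
  · have hf' := BanachLatticeOver.nonneg_prod_iff.1 hf
    obtain ⟨t₁, ht₁⟩ := hT₁ f.1 hf'.1
    obtain ⟨t₂, ht₂⟩ := hT₂ f.2 hf'.2
    exact ⟨max t₁ t₂, fun t ht => hnonneg t f hf (ht₁ t (le_of_max_le_left ht))
      (ht₂ t (le_of_max_le_right ht))⟩
  · rintro ⟨t₁, ht₁⟩ ⟨t₂, ht₂⟩
    refine ⟨max t₁ t₂, fun f hf t ht => ?_⟩
    have hf' := BanachLatticeOver.nonneg_prod_iff.1 hf
    exact hnonneg t f hf (ht₁ f.1 hf'.1 t (le_of_max_le_left ht))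
      (ht₂ f.2 hf'.2 t (le_of_max_le_right ht))
  · refine C0Semigroup.persistentlyIrreducible_of_coupled hlim hpos (fun f hf => ?_)
      (fun f hf => ?_) hT₁ hT₂ hI₁ hI₂ hB₁₂ hB₂₁
    -- Positivity of the coupling operators themselves is the case `s = t = 0` of the hypotheses.
    · simpa [C0Semigroup.map_zero] using h₁₂ 0 0 f hf
    · simpa [C0Semigroup.map_zero] using h₂₁ 0 0 f hf
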